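/- A two-player win-lose coordination game (WLC-game) consists of two disjoint, finite, non-empty choice sets $C_1,C_2$ (for players 1 and 2) and a winning relation $W\subseteq C_1\times C_2$ such that every choice occurs in at least one winning pair. In a repeated play of such a game $G$, in each round both players simultaneously and independently select a choice, knowing the full history $\mathcal H$ (the sequence of the pairs selected in the earlier rounds), until a pair in $W$ is selected (coordination). A pair $(G,\mathcal H)$ is a stage. A protocol assigns to each player $i$ and each stage $(G,\mathcal H)$ of each WLC-game a probability distribution on $C_i$. A renaming between two stages is a bijection of the (disjoint unions of the) choice sets, together with a permutation of the two players, which maps each player's choices onto the choices of the corresponding player, preserves winning and non-winning pairs, and maps the history, round by round, to the history; renamings between games are renamings between their initial stages (with empty histories). All protocols are assumed to be structural, i.e., invariant under renamings between stages. The expected coordination time (ECT) of a protocol in $G$ is the expected value (possibly $\infty$) of the number of rounds until coordination, from the empty history, when both players follow the protocol. The optimal ECT of $G$ is the minimum of the ECTs of structural protocols in $G$. The greatest optimal ECT among a class $\mathcal G$ of games is a value $r$ such that $r$ is the optimal ECT of some $G\in\mathcal G$ and, for every $G\in\mathcal G$, some structural protocol has ECT at most $r$ in $G$. For $m\ge 1$,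 an $m$-choice game is a two-player WLC-game with $\max\{|C_1|,|C_2|\}=m$. Let $\mathrm{CM}_m$ be the $m$-choice game with $|C_1|=|C_2|=m$ whose winning pairs form the graph of a bijection between $C_1$ and $C_2$. Let $G(1\times 2+2\times 1)$ be the $3$-choice game with $C_1=\{a_1,b_1,c_1\}$, $C_2=\{a_2,b_2,c_2\}$ and $W=\{(a_1,b_2),(a_1,c_2),(b_1,a_2),(c_1,a_2)\}$. Theorem. The greatest optimal ECT among $m$-choice games is: 1. $3-\frac{2}{m}$ for every integer $m\ge 1$ with $m\notin\{3,5\}$; 2. $2+\frac13$ for $m=5$; moreover, a $5$-choice game has optimal ECT $2+\frac13$ if and only if there is a renaming between it and $\mathrm{CM}_5$; 3. $\frac{1+\sqrt{4+\sqrt{17}}}{2}$ for $m=3$; moreover, a $3$-choice game has optimal ECT $\frac{1+\sqrt{4+\sqrt{17}}}{2}$ if and only if there is a renaming between it and $G(1\times 2+2\times 1)$. -/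

import Mathlib

open scoped ENNReal

noncomputable section

/-- An `n`-player win-lose coordination game. The choice sets of the players are separate types, so
that they are pairwise disjoint, and the domain of the game is their disjoint union. -/
structure WLCGame (n : ℕ) where
  Choice : Fin n → Type
  [fintypeChoice : ∀ i, Fintype (Choice i)]
  [nonemptyChoice : ∀ i, Nonempty (Choice i)]
  /-- the winning relation, a set of choice profiles -/
  win : Set (∀ i, Choice i)
  /-- no choice is surely losing -/
  exists_win : ∀ (i : Fin n) (c : Choice i), ∃ σ ∈ win, σ i = c

namespace WLCGame

attribute [instance] WLCGame.fintypeChoice WLCGame.nonemptyChoice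

variable {n : ℕ}

/-- A choice profile: one choice for each player. -/
abbrev Profile (G : WLCGame n) : Type := ∀ i, G.Choice i

/-- A history of a repeated play: the choice profiles of the past rounds, oldest first.
A stage is a game `G` together with a history `h : G.History`. -/
abbrev History (G : WLCGame n) : Type := List G.Profile

/-- A renaming between games (that is, between their initial stages): a permutation `β` of the
players and a bijection of the domains which maps the choices of player `β i` in `G` to the choices
of player `i` in `G'`, for each `i`, and respects the winning relations. -/
structure Renaming (G G' : WLCGame n) where
  perm : Equiv.Perm (Fin n)
  equiv : ∀ i, G.Choice (perm i) ≃ G'.Choice i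
  win_iff : ∀ σ : G.Profile, σ ∈ G.win ↔ (fun i => equiv i (σ (perm i))) ∈ G'.win

/-- The profile `(π(c_{β(1)}), …, π(c_{β(n)}))`. -/
def Renaming.mapProfile {G G' : WLCGame n} (r : Renaming G G') (σ : G.Profile) : G'.Profile :=
  fun i => r.equiv i (σ (r.perm i))

/-- The renaming `r` is a renaming between the stages `(G, h)` and `(G', h')`. -/
def Renaming.IsStageRenaming {G G' : WLCGame n} (r : Renaming G G')
    (h : G.History) (h' : G'.History) : Prop :=
  h' = h.map r.mapProfile

/-- A protocol: for each player and each stage of each game, a probability distribution on the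
choices of that player. -/
abbrev Protocol (n : ℕ) : Type 1 :=
  ∀ (i : Fin n) (G : WLCGame n), G.History → PMF (G.Choice i)

/-- A protocol is structural if it is indifferent with respect to renamings between stages. -/
def Protocol.IsStructural (π : Protocol n) : Prop :=
  ∀ (G G' : WLCGame n) (h : G.History) (h' : G'.History) (r : Renaming G G'),
    r.IsStageRenaming h h' →
      ∀ (i : Fin n) (c : G.Choice (r.perm i)), π (r.perm i) G h c = π i G' h' (r.equiv i c)

/-- The probability that the profile `σ` is chosen in the next round from the stage `(G, h)` when
all players, independently of each other, follow `π`. -/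
def Protocol.profileProb (π : Protocol n) (G : WLCGame n) (h : G.History) (σ : G.Profile) : ℝ≥0∞ :=
  ∏ i, π i G h (σ i)

open Classical in
/-- `π.coordProb G k h` is the probability that, when all players follow `π` from the stage
`(G, h)`, the first `k` further rounds fail and the round after them succeeds, so that coordination
takes exactly `k + 1` rounds. -/
def Protocol.coordProb (π : Protocol n) (G : WLCGame n) : ℕ → G.History → ℝ≥0∞
  | 0, h => ∑ σ : G.Profile, if σ ∈ G.win then π.profileProb G h σ else 0
  | k + 1, h => ∑ σ : G.Profile,
      if σ ∈ G.win then 0 else π.profileProb G h σ * π.coordProb G k (h ++ [σ])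

/-- The expected coordination time from the stage `(G, h)` with `π`: the expected value of the
number of rounds until coordination, which is `∞` on the plays that never coordinate
(here `∞ * 0 = 0`). -/
def Protocol.ectFrom (π : Protocol n) (G : WLCGame n) (h : G.History) : ℝ≥0∞ :=
  (∑' k : ℕ, ((k + 1 : ℕ) : ℝ≥0∞) * π.coordProb G k h) + ∞ * (1 - ∑' k : ℕ, π.coordProb G k h)

/-- The expected coordination time in `G` with `π`. -/
def Protocol.ect (π : Protocol n) (G : WLCGame n) : ℝ≥0∞ := π.ectFrom G []

/-- `r` is the optimal expected coordination time of `G`: the minimum of the expected coordination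
times given by (structural) protocols. -/
def IsOptimalECT (G : WLCGame n) (r : ℝ≥0∞) : Prop :=
  IsLeast {t : ℝ≥0∞ | ∃ π : Protocol n, π.IsStructural ∧ π.ect G = t} r

/-- `r` is the greatest optimal expected coordination time among the games in the class `𝒢`. -/
def IsGreatestOptimalECT (𝒢 : Set (WLCGame n)) (r : ℝ≥0∞) : Prop :=
  (∃ G ∈ 𝒢, IsOptimalECT G r) ∧
    ∀ G ∈ 𝒢, ∃ π : Protocol n, π.IsStructural ∧ π.ect G ≤ r

/-- The class of `m`-choice games: the two-player games of size `m`. -/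
def choiceGames (m : ℕ) : Set (WLCGame 2) :=
  {G | max (Fintype.card (G.Choice 0)) (Fintype.card (G.Choice 1)) = m}

/-- The two-player choice matching game with `m` choices for each player. -/
def choiceMatching (m : ℕ) [NeZero m] : WLCGame 2 where
  Choice := fun _ => Fin m
  win := {σ | σ 0 = σ 1}
  exists_win := fun _ c => ⟨fun _ => c, rfl, rfl⟩

/-- The game `G(m₁ × ⋯ × mₙ)`: player `i` has `mᵢ` choices and every profile is winning. -/
def universal (m : Fin n → ℕ) [∀ i, NeZero (m i)] : WLCGame n where
  Choice := fun i => Fin (m i)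
  win := Set.univ
  exists_win := fun i c => ⟨Function.update (fun _ => 0) i c, trivial, by simp⟩

/-- The disjoint union `G(A + B)` of two games: each player has the disjoint union of her choices
in the two games, and the winning relation is the union of the two winning relations. -/
def disjointUnion (G H : WLCGame n) : WLCGame n where
  Choice := fun i => G.Choice i ⊕ H.Choice i
  win := {σ | (∃ τ ∈ G.win, σ = fun i => Sum.inl (τ i)) ∨ (∃ τ ∈ H.win, σ = fun i => Sum.inr (τ i))}
  exists_win := by
    rintro i (c | c)
    · obtain ⟨τ, hτ, rfl⟩ := G.exists_win i c
      exact ⟨_, Or.inl ⟨τ, hτ, rfl⟩, rfl⟩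
    · obtain ⟨τ, hτ, rfl⟩ := H.exists_win i c
      exact ⟨_, Or.inr ⟨τ, hτ, rfl⟩, rfl⟩

instance neZero_one_two : ∀ i, NeZero ((![1, 2] : Fin 2 → ℕ) i) := by
  intro i; fin_cases i <;> exact ⟨by simp⟩

instance neZero_two_one : ∀ i, NeZero ((![2, 1] : Fin 2 → ℕ) i) := by
  intro i; fin_cases i <;> exact ⟨by simp⟩

/-- The game `G(1 × 2 + 2 × 1)`. -/
def oneTwoTwoOne : WLCGame 2 := disjointUnion (universal ![1, 2]) (universal ![2, 1])

end WLCGame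

end

/-! The expected coordination time (ECT) is the sum over k of the probability that the first k
rounds all fail. Hence it is bounded from either side by comparing a function of the history with
its own one-step expectation (`Protocol.le_ectFrom`, `Protocol.ectFrom_le`).

Upper bound 3 - 2/m. A uniform first round wins with probability at least 1/m, since there are at
least max(|C₁|, |C₂|) winning pairs. Afterwards each player tosses a fair coin between repeating the
first choice and replying to the opponent's first choice, so every later round wins with probability
at least 1/2. Any other renaming-invariant first round may replace the uniform one; if it wins with
probability p, the ECT is at most 3 - 2p.

Lower bound for the matching game. As long as failures are "mirrored", exchanging the players
together with an involution of the choices is a symmetry of the stage, and so is every permutation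
of the untouched choices. A structural protocol must therefore give one player the mirror image of
the other's distribution, constant on untouched choices. Playing a mirrored touched pair changes
nothing; playing two different untouched choices leaves two fewer of them. The resulting recursion
(`mirrorValue_le`) has value 2 except with 1 or 3 untouched choices, where avoiding touched choices
gives 1 and 5/3. The first round then gives 1 + 2(m-1)/m in general, but 1 + (4/5)(5/3) = 7/3 for m
= 5 and only 5/3 for m = 3.

For m = 5 every other game has a dense winning relation, a choice singled out by its degree, or a
dense core of winning pairs between choices of degree two; each gives an ECT below 7/3.

For m = 3 the same tools leave only the cross game G(1 × 2 + 2 × 1), where the players must choose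
between hub and leaf. Its value solves two quadratic recursions: α² - α = β before any pair of
leaves was played, and 2β² = 3β + 1 after one was played while the players are still
interchangeable. Both inequalities are completions of a square, so choosing a leaf with probability
1/α, then 1/β, is optimal. -/

noncomputable section

namespace WLCGame

/-! ### Survival probabilities, one-step bounds for the ECT, invariance under renamings. -/

section Basic

variable {n : ℕ} {G G' : WLCGame n}

/-- The bijection between profiles induced by a renaming. -/
def Renaming.profileEquiv (r : Renaming G G') : G.Profile ≃ G'.Profile :=
  (Equiv.piCongrLeft G.Choice r.perm).symm.trans (Equiv.piCongrRight r.equiv)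

theorem Renaming.profileEquiv_apply (r : Renaming G G') (σ : G.Profile) :
    r.profileEquiv σ = r.mapProfile σ := rfl

theorem Renaming.mapProfile_apply (r : Renaming G G') (σ : G.Profile) (i : Fin n) :
    r.mapProfile σ i = r.equiv i (σ (r.perm i)) := rfl

theorem Renaming.mapProfile_mem_win (r : Renaming G G') (σ : G.Profile) :
    r.mapProfile σ ∈ G'.win ↔ σ ∈ G.win := (r.win_iff σ).symm

theorem Renaming.mapProfile_surjective (r : Renaming G G') : Function.Surjective r.mapProfile :=
  r.profileEquiv.surjective

/-- The probability, as a real number, of a profile in the next round. -/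
def Protocol.prob (π : Protocol n) (G : WLCGame n) (h : G.History) (σ : G.Profile) : ℝ :=
  ∏ i, (π i G h (σ i)).toReal

theorem Protocol.prob_nonneg (π : Protocol n) (h : G.History) (σ : G.Profile) :
    0 ≤ π.prob G h σ := Finset.prod_nonneg fun _ _ => ENNReal.toReal_nonneg

theorem sum_toReal_pmf {α : Type*} [Fintype α] (p : PMF α) : ∑ a, (p a).toReal = 1 := by
  rw [← ENNReal.toReal_sum fun a _ => p.apply_ne_top a, ← tsum_fintype (L := .unconditional _), p.tsum_coe]
  simp

theorem Protocol.sum_prob (π : Protocol n) (h : G.History) : ∑ σ, π.prob G h σ = 1 := by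
  have := Finset.prod_univ_sum (fun i => (Finset.univ : Finset (G.Choice i)))
    (fun i c => (π i G h c).toReal)
  simp only [sum_toReal_pmf, Finset.prod_const_one] at this
  rw [Fintype.piFinset_univ] at this
  exact this.symm

theorem Protocol.profileProb_eq (π : Protocol n) (h : G.History) (σ : G.Profile) :
    π.profileProb G h σ = ENNReal.ofReal (π.prob G h σ) := by
  rw [Protocol.profileProb, Protocol.prob,
    ENNReal.ofReal_prod_of_nonneg fun _ _ => ENNReal.toReal_nonneg]
  exact Finset.prod_congr rfl fun i _ => (ENNReal.ofReal_toReal (PMF.apply_ne_top _ _)).symm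

open Classical in
/-- The probability of winning in the next round. -/
def Protocol.winProb (π : Protocol n) (G : WLCGame n) (h : G.History) : ℝ :=
  ∑ σ, if σ ∈ G.win then π.prob G h σ else 0

open Classical in
/-- The probability that the next `k` rounds all fail. -/
def Protocol.surv (π : Protocol n) (G : WLCGame n) : ℕ → G.History → ℝ
  | 0, _ => 1
  | k + 1, h => ∑ σ, if σ ∈ G.win then 0 else π.prob G h σ * π.surv G k (h ++ [σ])

open Classical in
theorem Protocol.sum_fail (π : Protocol n) (h : G.History) :
    ∑ σ, (if σ ∈ G.win then 0 else π.prob G h σ) = 1 - π.winProb G h := by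
  rw [eq_sub_iff_add_eq, winProb, ← Finset.sum_add_distrib, ← π.sum_prob h]
  exact Finset.sum_congr rfl fun σ _ => by split_ifs <;> simp

theorem Protocol.surv_nonneg (π : Protocol n) (k : ℕ) (h : G.History) : 0 ≤ π.surv G k h := by
  induction k generalizing h with
  | zero => exact zero_le_one
  | succ k ih =>
    refine Finset.sum_nonneg fun σ _ => ?_
    split_ifs
    · exact le_rfl
    · exact mul_nonneg (π.prob_nonneg h σ) (ih _)

theorem Protocol.winProb_nonneg (π : Protocol n) (h : G.History) : 0 ≤ π.winProb G h :=
  Finset.sum_nonneg fun σ _ => by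
    split_ifs
    · exact π.prob_nonneg h σ
    · exact le_rfl

theorem Protocol.surv_succ_le (π : Protocol n) (k : ℕ) (h : G.History) :
    π.surv G (k + 1) h ≤ π.surv G k h := by
  induction k generalizing h with
  | zero =>
    have := π.sum_fail h
    have h0 := π.winProb_nonneg h
    simp only [surv, mul_one]
    linarith
  | succ k ih =>
    refine Finset.sum_le_sum fun σ _ => ?_
    split_ifs
    · exact le_rfl
    · exact mul_le_mul_of_nonneg_left (ih _) (π.prob_nonneg h σ)

/-- Success in exactly round k + 1 is the drop of the survival probability, which reduces the
definition of the ECT to real tail probabilities. -/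
theorem Protocol.coordProb_eq (π : Protocol n) (k : ℕ) (h : G.History) :
    π.coordProb G k h = ENNReal.ofReal (π.surv G k h - π.surv G (k + 1) h) := by
  classical
  induction k generalizing h with
  | zero =>
    have := π.sum_fail h
    simp only [surv, mul_one, coordProb]
    rw [this, sub_sub_cancel, winProb, ENNReal.ofReal_sum_of_nonneg]
    · refine Finset.sum_congr rfl fun σ _ => ?_
      split_ifs <;> simp [profileProb_eq]
    · intro σ _
      split_ifs
      · exact π.prob_nonneg h σ
      · exact le_rfl
  | succ k ih =>
    have : π.surv G (k + 1) h - π.surv G (k + 1 + 1) h = ∑ σ, if σ ∈ G.win then 0 else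
        π.prob G h σ * (π.surv G k (h ++ [σ]) - π.surv G (k + 1) (h ++ [σ])) := by
      rw [surv, surv, ← Finset.sum_sub_distrib]
      refine Finset.sum_congr rfl fun σ _ => ?_
      split_ifs
      · simp
      · ring
    rw [this, ENNReal.ofReal_sum_of_nonneg, coordProb]
    · refine Finset.sum_congr rfl fun σ _ => ?_
      split_ifs
      · simp
      · rw [ENNReal.ofReal_mul (π.prob_nonneg h σ), profileProb_eq, ih]
    · intro σ _
      split_ifs
      · exact le_rfl
      · exact mul_nonneg (π.prob_nonneg h σ) (sub_nonneg.2 (π.surv_succ_le _ _))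

open Filter Topology in
/-- Abel summation for the expectation of a waiting time with tail probabilities `s`. -/
theorem tsum_succ_mul_sub_add (s : ℕ → ℝ) (h0 : s 0 = 1) (hs : ∀ k, 0 ≤ s k)
    (hanti : ∀ k, s (k + 1) ≤ s k) :
    (∑' k : ℕ, ((k + 1 : ℕ) : ℝ≥0∞) * ENNReal.ofReal (s k - s (k + 1))) +
      ∞ * (1 - ∑' k : ℕ, ENNReal.ofReal (s k - s (k + 1))) = ∑' k, ENNReal.ofReal (s k) := by
  have hA : Antitone s := antitone_nat_of_succ_le hanti
  obtain ⟨L, hL⟩ : ∃ L, Tendsto s atTop (𝓝 L) :=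
    ⟨_, tendsto_atTop_ciInf hA ⟨0, by rintro _ ⟨k, rfl⟩; exact hs k⟩⟩
  have hLle : ∀ k, L ≤ s k := fun k => hA.le_of_tendsto hL k
  have hL0 : 0 ≤ L := ge_of_tendsto' hL hs
  have tele : ∀ k, ∑' j, ENNReal.ofReal (s (j + k) - s (j + k + 1)) = ENNReal.ofReal (s k - L) := by
    intro k
    have h1 : HasSum (fun j => s (j + k) - s (j + k + 1)) (s k - L) := by
      rw [hasSum_iff_tendsto_nat_of_nonneg fun j => sub_nonneg.2 (hanti _)]
      have : ∀ N, ∑ j ∈ Finset.range N, (s (j + k) - s (j + k + 1)) = s k - s (N + k) := by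
        intro N
        induction N with
        | zero => simp
        | succ N ih => rw [Finset.sum_range_succ, ih, show N + 1 + k = N + k + 1 by ring]; ring
      simp only [this]
      exact tendsto_const_nhds.sub (hL.comp (tendsto_add_atTop_nat k))
    rw [← h1.tsum_eq, ENNReal.ofReal_tsum_of_nonneg (fun j => sub_nonneg.2 (hanti _)) h1.summable]
  have t0 := tele 0
  simp only [add_zero, h0] at t0
  -- The limit L is the probability of never coordinating. If it vanishes, the claim is a double sum
  -- in two orders; otherwise both sides are infinite.
  rcases hL0.eq_or_lt with rfl | hpos
  · rw [t0]
    simp only [sub_zero, ENNReal.ofReal_one, tsub_self, mul_zero, add_zero]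
    have e1 : ∀ k, ENNReal.ofReal (s k) =
        ∑' j, if k ≤ j then ENNReal.ofReal (s j - s (j + 1)) else 0 := by
      intro k
      have h1 := Summable.sum_add_tsum_nat_add' (k := k)
        (f := fun j => if k ≤ j then ENNReal.ofReal (s j - s (j + 1)) else 0) ENNReal.summable
      rw [← h1, Finset.sum_eq_zero, zero_add]
      · have h2 : ∀ i, k ≤ i + k := fun i => Nat.le_add_left k i
        simp only [h2, if_true]
        rw [tele k, sub_zero]
      · intro i hi
        rw [if_neg (by simpa using hi)]
    simp_rw [e1]
    rw [ENNReal.tsum_comm]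
    refine tsum_congr fun j => ?_
    rw [tsum_eq_sum (s := Finset.range (j + 1))]
    · rw [Finset.sum_congr rfl (g := fun _ => ENNReal.ofReal (s j - s (j + 1)))]
      · simp
      · intro k hk
        rw [if_pos (by simpa [Nat.lt_succ_iff] using hk)]
    · intro k hk
      rw [if_neg (by simpa [Nat.lt_succ_iff] using hk)]
  · have e1 : ∑' k, ENNReal.ofReal (s k) = ∞ := by
      refine top_unique ?_
      calc ∞ = ∑' _ : ℕ, ENNReal.ofReal L :=
            (ENNReal.tsum_const_eq_top_of_ne_zero (by simpa using hpos)).symm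
        _ ≤ _ := ENNReal.tsum_le_tsum fun k => ENNReal.ofReal_le_ofReal (hLle k)
    rw [e1, t0, ENNReal.top_mul, add_top]
    rw [← ENNReal.ofReal_one, ← ENNReal.ofReal_sub _ (by linarith [hLle 0])]
    simpa using hpos

theorem Protocol.ectFrom_eq_tsum (π : Protocol n) (h : G.History) :
    π.ectFrom G h = ∑' k, ENNReal.ofReal (π.surv G k h) := by
  simp only [ectFrom, coordProb_eq]
  exact tsum_succ_mul_sub_add _ rfl (fun k => π.surv_nonneg k h) fun k => π.surv_succ_le k h

open Classical in
/-- A bounded function that is dominated by its one-step expectation bounds the expected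
coordination time from below. -/
theorem Protocol.le_ectFrom (π : Protocol n) (F : G.History → ℝ) (C : ℝ) (hC : ∀ h, F h ≤ C)
    (hF : ∀ h, F h ≤ 1 + ∑ σ, if σ ∈ G.win then 0 else π.prob G h σ * F (h ++ [σ]))
    (h : G.History) : ENNReal.ofReal (F h) ≤ π.ectFrom G h := by
  -- Unrolling the one-step inequality K times leaves the remainder C · surv K. It tends to 0 when
  -- the ECT is finite, because the survival probabilities are then summable.
  have key : ∀ K h, F h ≤ ∑ k ∈ Finset.range K, π.surv G k h + C * π.surv G K h := by
    intro K
    induction K with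
    | zero => intro h; simpa [surv] using hC h
    | succ K ih =>
      intro h
      refine (hF h).trans ?_
      rw [Finset.sum_range_succ']
      have : ∑ σ, (if σ ∈ G.win then 0 else π.prob G h σ * F (h ++ [σ])) ≤
          ∑ σ, if σ ∈ G.win then 0 else π.prob G h σ *
            (∑ k ∈ Finset.range K, π.surv G k (h ++ [σ]) + C * π.surv G K (h ++ [σ])) := by
        refine Finset.sum_le_sum fun σ _ => ?_
        split_ifs
        · exact le_rfl
        · exact mul_le_mul_of_nonneg_left (ih _) (π.prob_nonneg h σ)
      have e : ∑ σ, (if σ ∈ G.win then 0 else π.prob G h σ *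
            (∑ k ∈ Finset.range K, π.surv G k (h ++ [σ]) + C * π.surv G K (h ++ [σ]))) =
          ∑ k ∈ Finset.range K, π.surv G (k + 1) h + C * π.surv G (K + 1) h := by
        simp only [surv]
        rw [Finset.sum_comm, Finset.mul_sum, ← Finset.sum_add_distrib]
        refine Finset.sum_congr rfl fun σ _ => ?_
        split_ifs
        · simp
        · rw [mul_add, Finset.mul_sum]; ring
      rw [e] at this
      have : π.surv G 0 h = 1 := rfl
      linarith
  rw [ectFrom_eq_tsum]
  by_cases htop : ∑' k, ENNReal.ofReal (π.surv G k h) = ∞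
  · rw [htop]; exact le_top
  have hsum : Summable fun k => π.surv G k h := by
    have := ENNReal.summable_toReal htop
    simpa [ENNReal.toReal_ofReal (π.surv_nonneg _ h)] using this
  rw [← ENNReal.ofReal_tsum_of_nonneg (fun k => π.surv_nonneg k h) hsum]
  refine ENNReal.ofReal_le_ofReal ?_
  have lim := hsum.hasSum.tendsto_sum_nat.add (hsum.tendsto_atTop_zero.const_mul C)
  rw [mul_zero, add_zero] at lim
  exact ge_of_tendsto' lim fun K => key K h

open Classical in
/-- A function that dominates its one-step expectation, on a set of histories that is closed under
the failing moves of positive probability, bounds the expected coordination time from above. -/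
theorem Protocol.ectFrom_le (π : Protocol n) (R : G.History → Prop) (F : G.History → ℝ)
    (hF0 : ∀ h, R h → 0 ≤ F h)
    (hR : ∀ h, R h → ∀ σ, σ ∉ G.win → π.prob G h σ ≠ 0 → R (h ++ [σ]))
    (hF : ∀ h, R h → 1 + ∑ σ, (if σ ∈ G.win then 0 else π.prob G h σ * F (h ++ [σ])) ≤ F h)
    (h : G.History) (hh : R h) : π.ectFrom G h ≤ ENNReal.ofReal (F h) := by
  have key : ∀ K h, R h → ∑ k ∈ Finset.range K, π.surv G k h ≤ F h := by
    intro K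
    induction K with
    | zero => intro h hh; simpa using hF0 h hh
    | succ K ih =>
      intro h hh
      refine le_trans ?_ (hF h hh)
      rw [Finset.sum_range_succ', add_comm]
      simp only [surv]
      rw [Finset.sum_comm]
      refine add_le_add_right (Finset.sum_le_sum fun σ _ => ?_) _
      split_ifs with hw
      · simp
      · rw [← Finset.mul_sum]
        by_cases hp : π.prob G h σ = 0
        · simp [hp]
        · exact mul_le_mul_of_nonneg_left (ih _ (hR h hh σ hw hp)) (π.prob_nonneg h σ)
  rw [ectFrom_eq_tsum]
  refine ENNReal.tsum_le_of_sum_range_le fun K => ?_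
  rw [← ENNReal.ofReal_sum_of_nonneg fun k _ => π.surv_nonneg k h]
  exact ENNReal.ofReal_le_ofReal (key K h hh)

/-- If every failing move of positive probability leads to a stage with expected coordination time
at most `C`, the expected coordination time is at most `1 + (1 - w) C`, where `w` bounds the
probability of winning in the next round from below. -/
theorem Protocol.ectFrom_le_step (π : Protocol n) (h : G.History) (C w : ℝ) (hC : 0 ≤ C)
    (hw : w ≤ π.winProb G h)
    (hσ : ∀ σ, σ ∉ G.win → π.prob G h σ ≠ 0 → π.ectFrom G (h ++ [σ]) ≤ ENNReal.ofReal C) :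
    π.ectFrom G h ≤ ENNReal.ofReal (1 + (1 - w) * C) := by
  classical
  rw [ectFrom_eq_tsum, tsum_eq_zero_add' ENNReal.summable]
  have e1 : ∑' k, ENNReal.ofReal (π.surv G (k + 1) h) =
      ∑ σ, if σ ∈ G.win then 0 else ENNReal.ofReal (π.prob G h σ) * π.ectFrom G (h ++ [σ]) := by
    have : ∀ k, ENNReal.ofReal (π.surv G (k + 1) h) = ∑ σ, if σ ∈ G.win then 0 else
        ENNReal.ofReal (π.prob G h σ) * ENNReal.ofReal (π.surv G k (h ++ [σ])) := by
      intro k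
      rw [surv, ENNReal.ofReal_sum_of_nonneg]
      · refine Finset.sum_congr rfl fun σ _ => ?_
        split_ifs
        · simp
        · rw [ENNReal.ofReal_mul (π.prob_nonneg h σ)]
      · intro σ _
        split_ifs
        · exact le_rfl
        · exact mul_nonneg (π.prob_nonneg h σ) (π.surv_nonneg _ _)
    simp_rw [this]
    rw [Summable.tsum_finsetSum fun _ _ => ENNReal.summable]
    refine Finset.sum_congr rfl fun σ _ => ?_
    split_ifs
    · simp
    · rw [ENNReal.tsum_mul_left, ectFrom_eq_tsum]
  have e2 : (∑ σ, if σ ∈ G.win then 0 else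
      ENNReal.ofReal (π.prob G h σ) * π.ectFrom G (h ++ [σ])) ≤
      ENNReal.ofReal ((1 - π.winProb G h) * C) := by
    rw [← π.sum_fail h, Finset.sum_mul, ENNReal.ofReal_sum_of_nonneg]
    · refine Finset.sum_le_sum fun σ _ => ?_
      split_ifs with hw
      · simp
      · rw [ENNReal.ofReal_mul (π.prob_nonneg h σ)]
        by_cases hp : π.prob G h σ = 0
        · simp [hp]
        · exact mul_le_mul_right (hσ σ hw hp) _
    · intro σ _
      split_ifs
      · simp
      · exact mul_nonneg (π.prob_nonneg h σ) hC
  have hw1 : 0 ≤ 1 - π.winProb G h := by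
    rw [← π.sum_fail h]
    exact Finset.sum_nonneg fun σ _ => by
      split_ifs
      · exact le_rfl
      · exact π.prob_nonneg h σ
  rw [e1, ENNReal.ofReal_add zero_le_one (mul_nonneg (by linarith) hC)]
  exact add_le_add le_rfl (e2.trans (ENNReal.ofReal_le_ofReal
    (mul_le_mul_of_nonneg_right (by linarith) hC)))

theorem Protocol.IsStructural.prob_eq {π : Protocol n} (hπ : π.IsStructural) (r : Renaming G G')
    (h : G.History) (σ : G.Profile) :
    π.prob G' (h.map r.mapProfile) (r.mapProfile σ) = π.prob G h σ := by
  rw [Protocol.prob, Protocol.prob,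
    ← Equiv.prod_comp r.perm fun i => (π i G h (σ i)).toReal]
  exact Finset.prod_congr rfl fun i _ =>
    congrArg ENNReal.toReal (hπ G G' h _ r rfl i (σ (r.perm i))).symm

/-- A renaming permutes the profiles and preserves winning and probabilities, so the recursion
carries over term by term. Optimal ECTs thus depend only on the renaming class. -/
theorem Protocol.IsStructural.surv_eq {π : Protocol n} (hπ : π.IsStructural) (r : Renaming G G')
    (k : ℕ) (h : G.History) : π.surv G' k (h.map r.mapProfile) = π.surv G k h := by
  induction k generalizing h with
  | zero => rfl
  | succ k ih =>
    rw [Protocol.surv, Protocol.surv, ← Equiv.sum_comp r.profileEquiv]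
    refine Finset.sum_congr rfl fun σ _ => ?_
    have := ih (h ++ [σ])
    rw [List.map_append, List.map_singleton] at this
    by_cases hw : σ ∈ G.win
    · rw [r.profileEquiv_apply, if_pos hw, if_pos ((r.mapProfile_mem_win σ).2 hw)]
    · rw [r.profileEquiv_apply, if_neg hw, if_neg (mt (r.mapProfile_mem_win σ).1 hw), hπ.prob_eq,
        this]

theorem Protocol.IsStructural.ect_eq {π : Protocol n} (hπ : π.IsStructural) (r : Renaming G G') :
    π.ect G' = π.ect G := by
  have : ∀ k, π.surv G' k [] = π.surv G k [] := fun k => by simpa using hπ.surv_eq r k []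
  simp only [Protocol.ect, Protocol.ectFrom_eq_tsum, this]

theorem Renaming.isOptimalECT_iff (r : Renaming G G') (t : ℝ≥0∞) :
    IsOptimalECT G' t ↔ IsOptimalECT G t := by
  have : {t : ℝ≥0∞ | ∃ π : Protocol n, π.IsStructural ∧ π.ect G' = t} =
      {t : ℝ≥0∞ | ∃ π : Protocol n, π.IsStructural ∧ π.ect G = t} := by
    ext t
    constructor <;> rintro ⟨π, hπ, h⟩ <;> exact ⟨π, hπ, by rw [← h, hπ.ect_eq r]⟩
  rw [IsOptimalECT, IsOptimalECT, this]

end Basic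

/-! ### Protocols given by real weights, and uniform weights. -/

section Weights

variable {n : ℕ} {G G' : WLCGame n}

/-- The protocol with the given probabilities of the choices. -/
def Protocol.ofWeights (w : ∀ (i : Fin n) (G : WLCGame n), G.History → G.Choice i → ℝ)
    (h0 : ∀ i G h c, 0 ≤ w i G h c) (h1 : ∀ i G h, ∑ c, w i G h c = 1) : Protocol n :=
  fun i G h => PMF.ofFintype (fun c => ENNReal.ofReal (w i G h c)) (by
    rw [← ENNReal.ofReal_sum_of_nonneg fun c _ => h0 i G h c, h1, ENNReal.ofReal_one])

variable {w : ∀ (i : Fin n) (G : WLCGame n), G.History → G.Choice i → ℝ}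
  {h0 : ∀ i G h c, 0 ≤ w i G h c} {h1 : ∀ i G h, ∑ c, w i G h c = 1}

theorem Protocol.ofWeights_prob (h : G.History) (σ : G.Profile) :
    (Protocol.ofWeights w h0 h1).prob G h σ = ∏ i, w i G h (σ i) :=
  Finset.prod_congr rfl fun i _ => ENNReal.toReal_ofReal (h0 i G h _)

theorem Protocol.ofWeights_isStructural
    (hw : ∀ (G G' : WLCGame n) (r : Renaming G G') (h : G.History) (i : Fin n)
      (c : G.Choice (r.perm i)), w (r.perm i) G h c = w i G' (h.map r.mapProfile) (r.equiv i c)) :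
    (Protocol.ofWeights w h0 h1).IsStructural := by
  rintro G G' h _ r rfl i c
  exact congrArg ENNReal.ofReal (hw G G' r h i c)

theorem Renaming.mapProfile_update (r : Renaming G G') (σ : G.Profile) (i : Fin n)
    (c : G.Choice (r.perm i)) :
    r.mapProfile (Function.update σ (r.perm i) c) =
      Function.update (r.mapProfile σ) i (r.equiv i c) := by
  ext j
  by_cases hj : j = i
  · subst hj
    simp [mapProfile_apply]
  · have : r.perm j ≠ r.perm i := fun h => hj (r.perm.injective h)
    simp [mapProfile_apply, hj, this]

end Weights

section Unif

variable {α β : Type*} [Fintype α] [Fintype β]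

open Classical in
/-- The uniform weights on `S` (on the whole type if `S` is empty). -/
def unif (S : Finset α) (c : α) : ℝ :=
  if S.Nonempty then if c ∈ S then (S.card : ℝ)⁻¹ else 0 else (Fintype.card α : ℝ)⁻¹

theorem unif_nonneg (S : Finset α) (c : α) : 0 ≤ unif S c := by
  unfold unif
  split_ifs <;> positivity

theorem sum_unif [Nonempty α] (S : Finset α) : ∑ c, unif S c = 1 := by
  classical
  unfold unif
  split_ifs with h
  · have : (S.card : ℝ) ≠ 0 := by exact_mod_cast h.card_pos.ne'
    simp [this]
  · simp

theorem unif_equiv {S : Finset α} {T : Finset β} (e : α ≃ β) (h : ∀ c, c ∈ S ↔ e c ∈ T) (c : α) :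
    unif S c = unif T (e c) := by
  classical
  have hT : T = S.map e.toEmbedding := by
    ext b
    simp only [Finset.mem_map_equiv, h, e.apply_symm_apply]
  subst hT
  simp [unif, Fintype.card_congr e]

theorem unif_of_mem {S : Finset α} {c : α} (hc : c ∈ S) : unif S c = (S.card : ℝ)⁻¹ := by
  classical
  rw [unif, if_pos ⟨c, hc⟩, if_pos hc]

theorem unif_ne_zero {S : Finset α} (hS : S.Nonempty) {c : α} (hc : unif S c ≠ 0) : c ∈ S := by
  classical
  by_contra h
  exact hc (by rw [unif, if_pos hS, if_neg h])

end Unif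

/-! ### Winning probabilities for a pair of independent distributions. -/

section TwoPlayer

variable {G : WLCGame 2}

/-- The profile of two given choices. -/
def pair (a : G.Choice 0) (b : G.Choice 1) : G.Profile := (piFinTwoEquiv G.Choice).symm (a, b)

@[simp] theorem pair_zero (a : G.Choice 0) (b : G.Choice 1) : pair a b 0 = a := rfl
@[simp] theorem pair_one (a : G.Choice 0) (b : G.Choice 1) : pair a b 1 = b := rfl

@[simp] theorem pair_eta (σ : G.Profile) : pair (σ 0) (σ 1) = σ :=
  (piFinTwoEquiv G.Choice).symm_apply_apply σ

theorem profile_ext {σ τ : G.Profile} (h0 : σ 0 = τ 0) (h1 : σ 1 = τ 1) : σ = τ := by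
  rw [← pair_eta σ, ← pair_eta τ, h0, h1]

theorem sum_profile (f : G.Profile → ℝ) : ∑ σ, f σ = ∑ a, ∑ b, f (pair a b) := by
  rw [← Fintype.sum_prod_type', ← Equiv.sum_comp (piFinTwoEquiv G.Choice).symm f]
  rfl

open Classical in
/-- The probability of winning if the two players use the weights `u` and `v`. -/
def winSum (G : WLCGame 2) (u : G.Choice 0 → ℝ) (v : G.Choice 1 → ℝ) : ℝ :=
  ∑ σ : G.Profile, if σ ∈ G.win then u (σ 0) * v (σ 1) else 0

/-- Expanding the product of the two averages gives four nonnegative terms; the two in which both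
players use the same component are dropped. -/
theorem winSum_mix {u u' : G.Choice 0 → ℝ} {v v' : G.Choice 1 → ℝ} (hu : ∀ c, 0 ≤ u c)
    (hu' : ∀ c, 0 ≤ u' c) (hv : ∀ c, 0 ≤ v c) (hv' : ∀ c, 0 ≤ v' c) :
    4⁻¹ * winSum G u v' + 4⁻¹ * winSum G u' v ≤
      winSum G (fun c => 2⁻¹ * u c + 2⁻¹ * u' c) (fun c => 2⁻¹ * v c + 2⁻¹ * v' c) := by
  rw [winSum, winSum, winSum, Finset.mul_sum, Finset.mul_sum, ← Finset.sum_add_distrib]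
  refine Finset.sum_le_sum fun σ _ => ?_
  split_ifs
  · have := mul_nonneg (hu (σ 0)) (hv (σ 1))
    have := mul_nonneg (hu' (σ 0)) (hv' (σ 1))
    linarith
  · simp

theorem sum_mul_profile (u : G.Choice 0 → ℝ) (v : G.Choice 1 → ℝ) :
    ∑ σ : G.Profile, u (σ 0) * v (σ 1) = (∑ a, u a) * ∑ b, v b := by
  rw [sum_profile, Finset.sum_mul_sum]
  rfl

theorem winSum_eq_one {u : G.Choice 0 → ℝ} {v : G.Choice 1 → ℝ} (hu : ∑ a, u a = 1)
    (hv : ∑ b, v b = 1) (h : ∀ σ : G.Profile, u (σ 0) ≠ 0 → v (σ 1) ≠ 0 → σ ∈ G.win) :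
    winSum G u v = 1 := by
  have : winSum G u v = ∑ σ : G.Profile, u (σ 0) * v (σ 1) := by
    refine Finset.sum_congr rfl fun σ _ => ?_
    split_ifs with hw
    · rfl
    · by_contra hne
      exact hw (h σ (left_ne_zero_of_mul (Ne.symm hne)) (right_ne_zero_of_mul (Ne.symm hne)))
  rw [this, sum_mul_profile, hu, hv, one_mul]

open Classical in
theorem winSum_unif {S : Finset (G.Choice 0)} {T : Finset (G.Choice 1)} (hS : S.Nonempty)
    (hT : T.Nonempty) : winSum G (unif S) (unif T) =
      (Finset.univ.filter fun σ : G.Profile => σ ∈ G.win ∧ σ 0 ∈ S ∧ σ 1 ∈ T).card /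
        ((S.card : ℝ) * T.card) := by
  have : ∀ σ : G.Profile, (if σ ∈ G.win then unif S (σ 0) * unif T (σ 1) else 0) =
      if σ ∈ G.win ∧ σ 0 ∈ S ∧ σ 1 ∈ T then ((S.card : ℝ) * T.card)⁻¹ else 0 := by
    intro σ
    simp only [unif, if_pos hS, if_pos hT]
    by_cases h1 : σ ∈ G.win <;> by_cases h2 : σ 0 ∈ S <;> by_cases h3 : σ 1 ∈ T <;>
      simp [h1, h2, h3, mul_comm]
  rw [winSum, Finset.sum_congr rfl fun σ _ => this σ, ← Finset.sum_filter, Finset.sum_const,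
    nsmul_eq_mul, div_eq_mul_inv]

theorem Protocol.winProb_ofWeights
    {w : ∀ (i : Fin 2) (G : WLCGame 2), G.History → G.Choice i → ℝ}
    {h0 : ∀ i G h c, 0 ≤ w i G h c} {h1 : ∀ i G h, ∑ c, w i G h c = 1} (h : G.History) :
    (Protocol.ofWeights w h0 h1).winProb G h = winSum G (w 0 G h) (w 1 G h) := by
  refine Finset.sum_congr rfl fun σ _ => ?_
  rw [Protocol.ofWeights_prob, Fin.prod_univ_two]

end TwoPlayer

/-! ### Wait-or-move: an invariant first round, then repeat or reply. -/

section TwoPhase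

variable {n : ℕ}

/-- A set of choices of each player of each game. -/
abbrev Family (n : ℕ) : Type 1 := ∀ (G : WLCGame n) (i : Fin n), Finset (G.Choice i)

/-- The family is indifferent with respect to renamings. -/
def Family.IsInvariant (A : Family n) : Prop :=
  ∀ (G G' : WLCGame n) (r : Renaming G G') (i : Fin n) (c : G.Choice (r.perm i)),
    c ∈ A G (r.perm i) ↔ r.equiv i c ∈ A G' i

open Classical in
/-- The choices of player `i` that win against the choices of the other players in `σ`. -/
def replies (G : WLCGame n) (σ : G.Profile) (i : Fin n) : Finset (G.Choice i) :=
  Finset.univ.filter fun c => Function.update σ i c ∈ G.win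

theorem mem_replies {G : WLCGame n} {σ : G.Profile} {i : Fin n} {c : G.Choice i} :
    c ∈ replies G σ i ↔ Function.update σ i c ∈ G.win := by
  simp [replies]

open Classical in
/-- The first round is played with the mean of the uniform distributions on `A` and `B`; after that
each player either repeats the choice of the first round or replies to it. -/
def twoPhaseWeights (A B : Family n) (i : Fin n) (G : WLCGame n) :
    G.History → G.Choice i → ℝ
  | [], c => 2⁻¹ * unif (A G i) c + 2⁻¹ * unif (B G i) c
  | σ :: _, c => 2⁻¹ * unif {σ i} c + 2⁻¹ * unif (replies G σ i) c

theorem twoPhaseWeights_nonneg (A B : Family n) (i : Fin n) (G : WLCGame n) (h : G.History)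
    (c : G.Choice i) : 0 ≤ twoPhaseWeights A B i G h c := by
  cases h <;> simp only [twoPhaseWeights] <;>
  exact add_nonneg (mul_nonneg (by norm_num) (unif_nonneg _ _))
      (mul_nonneg (by norm_num) (unif_nonneg _ _))

theorem sum_twoPhaseWeights (A B : Family n) (i : Fin n) (G : WLCGame n) (h : G.History) :
    ∑ c, twoPhaseWeights A B i G h c = 1 := by
  cases h <;> simp only [twoPhaseWeights, Finset.sum_add_distrib, ← Finset.mul_sum, sum_unif] <;>
  norm_num

/-- The protocol with the weights `twoPhaseWeights`. -/
def twoPhase (A B : Family n) : Protocol n :=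
  Protocol.ofWeights (twoPhaseWeights A B) (twoPhaseWeights_nonneg A B) (sum_twoPhaseWeights A B)

theorem twoPhase_isStructural {A B : Family n} (hA : A.IsInvariant) (hB : B.IsInvariant) :
    (twoPhase A B).IsStructural := by
  refine Protocol.ofWeights_isStructural fun G G' r h i c => ?_
  cases h with
  | nil =>
    simp only [twoPhaseWeights, List.map_nil]
    rw [unif_equiv (r.equiv i) (hA G G' r i), unif_equiv (r.equiv i) (hB G G' r i)]
  | cons σ h =>
    simp only [twoPhaseWeights, List.map_cons]
    rw [unif_equiv (r.equiv i) (T := {r.mapProfile σ i}), unif_equiv (r.equiv i)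
      (T := replies G' (r.mapProfile σ) i)]
    · intro c
      rw [mem_replies, mem_replies, ← r.mapProfile_update, r.mapProfile_mem_win]
    · intro c
      simp [r.mapProfile_apply]

/-- With two players a reply depends on a single opposing choice, and every choice occurs in some
winning pair. -/
theorem replies_nonempty (G : WLCGame 2) (σ : G.Profile) (i : Fin 2) : (replies G σ i).Nonempty := by
  obtain ⟨j, hj⟩ : ∃ j : Fin 2, j ≠ i := exists_ne i
  obtain ⟨τ, hτ, e⟩ := G.exists_win j (σ j)
  refine ⟨τ i, mem_replies.2 ?_⟩
  convert hτ
  ext k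
  by_cases hk : k = i
  · subst hk; simp
  · have : k = j := by omega
    subst this
    simp [hj, e]

theorem winSum_eq_one_of_replies {G : WLCGame 2} (σ : G.Profile) :
    winSum G (unif {σ 0}) (unif (replies G σ 1)) = 1 ∧
      winSum G (unif (replies G σ 0)) (unif {σ 1}) = 1 := by
  constructor <;> refine winSum_eq_one (sum_unif _) (sum_unif _) fun τ h0 h1 => ?_
  · have h0 := unif_ne_zero (Finset.singleton_nonempty _) h0
    have h1 := unif_ne_zero (replies_nonempty G σ 1) h1
    rw [Finset.mem_singleton] at h0
    convert mem_replies.1 h1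
    exact profile_ext (by simp [h0]) (by simp)
  · have h1 := unif_ne_zero (Finset.singleton_nonempty _) h1
    have h0 := unif_ne_zero (replies_nonempty G σ 0) h0
    rw [Finset.mem_singleton] at h1
    convert mem_replies.1 h0
    exact profile_ext (by simp) (by simp [h1])

theorem twoPhase_ectFrom_le (A B : Family 2) {G : WLCGame 2} (σ : G.Profile) (h : G.History) :
    (twoPhase A B).ectFrom G (σ :: h) ≤ ENNReal.ofReal 2 := by
  classical
  refine (twoPhase A B).ectFrom_le (fun h => ∃ t, h = σ :: t) (fun _ => 2) (by simp) ?_ ?_ _ ⟨h, rfl⟩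
  · rintro _ ⟨t, rfl⟩ τ - -
    exact ⟨t ++ [τ], rfl⟩
  · rintro _ ⟨t, rfl⟩
    -- One player repeats and the other replies with probability 1/4 + 1/4, and this always wins.
    -- Only the first profile of the history matters, so the bound persists and the constant 2
    -- satisfies the recursion.
    have h1 : 2⁻¹ ≤ (twoPhase A B).winProb G (σ :: t) := by
      rw [twoPhase, Protocol.winProb_ofWeights]
      refine le_trans ?_ (winSum_mix (unif_nonneg _) (unif_nonneg _) (unif_nonneg _) (unif_nonneg _))
      rw [(winSum_eq_one_of_replies σ).1, (winSum_eq_one_of_replies σ).2]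
      norm_num
    have h2 := (twoPhase A B).sum_fail (σ :: t)
    have h3 : ∑ τ, (if τ ∈ G.win then 0 else (twoPhase A B).prob G (σ :: t) τ * 2) =
        (1 - (twoPhase A B).winProb G (σ :: t)) * 2 := by
      rw [← h2, Finset.sum_mul]
      exact Finset.sum_congr rfl fun τ _ => by split_ifs <;> simp
    rw [h3]
    linarith

theorem twoPhase_ect_le (A B : Family 2) {G : WLCGame 2} {p : ℝ}
    (hp : p ≤ winSum G (fun c => 2⁻¹ * unif (A G 0) c + 2⁻¹ * unif (B G 0) c)
      fun c => 2⁻¹ * unif (A G 1) c + 2⁻¹ * unif (B G 1) c) :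
    (twoPhase A B).ect G ≤ ENNReal.ofReal (1 + (1 - p) * 2) := by
  refine (twoPhase A B).ectFrom_le_step [] 2 p (by norm_num) ?_ fun σ _ _ =>
    twoPhase_ectFrom_le A B σ []
  rw [twoPhase, Protocol.winProb_ofWeights]
  exact hp

/-- If both players first choose uniformly from an invariant family, win with probability at least
`p` in the first round, and then repeat or reply, the expected coordination time is at most
`1 + 2 (1 - p)`. -/
theorem exists_ect_le_of_family {A : Family 2} (hA : A.IsInvariant) {G : WLCGame 2} {p : ℝ}
    (hp : p ≤ winSum G (unif (A G 0)) (unif (A G 1))) :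
    ∃ π : Protocol 2, π.IsStructural ∧ π.ect G ≤ ENNReal.ofReal (1 + (1 - p) * 2) := by
  refine ⟨_, twoPhase_isStructural hA hA, twoPhase_ect_le A A ?_⟩
  convert hp using 3 <;> ring

/-- If one invariant family is played against another one, the first round is won with probability
at least `1 / 4` for each of the two pairs of families that wins surely. -/
theorem exists_ect_le_of_families {A B : Family 2} (hA : A.IsInvariant) (hB : B.IsInvariant)
    {G : WLCGame 2} (h1 : winSum G (unif (A G 0)) (unif (B G 1)) = 1)
    (h2 : winSum G (unif (B G 0)) (unif (A G 1)) = 1) :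
    ∃ π : Protocol 2, π.IsStructural ∧ π.ect G ≤ ENNReal.ofReal 2 := by
  refine ⟨_, twoPhase_isStructural hA hB, (twoPhase_ect_le A B (p := 2⁻¹) ?_).trans
    (ENNReal.ofReal_le_ofReal (by norm_num))⟩
  refine le_trans ?_ (winSum_mix (unif_nonneg _) (unif_nonneg _) (unif_nonneg _) (unif_nonneg _))
  rw [h1, h2]
  norm_num

end TwoPhase

/-! ### Loop avoidance: playing only untouched winning pairs. -/

section LoopAvoidance

variable {n : ℕ} {G G' : WLCGame n}

open Classical in
/-- The winning profiles that share no choice with a profile of the history. -/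
def untouchedWins (G : WLCGame n) (h : G.History) : Finset G.Profile :=
  Finset.univ.filter fun σ => σ ∈ G.win ∧ ∀ τ ∈ h, ∀ j, τ j ≠ σ j

open Classical in
/-- The choices of player `i` in the profiles of `untouchedWins`. -/
def untouchedChoices (G : WLCGame n) (h : G.History) (i : Fin n) : Finset (G.Choice i) :=
  (untouchedWins G h).image fun σ => σ i

theorem mem_untouchedWins {h : G.History} {σ : G.Profile} :
    σ ∈ untouchedWins G h ↔ σ ∈ G.win ∧ ∀ τ ∈ h, ∀ j, τ j ≠ σ j := by
  simp [untouchedWins]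

theorem mem_untouchedChoices {h : G.History} {i : Fin n} {c : G.Choice i} :
    c ∈ untouchedChoices G h i ↔ ∃ σ ∈ untouchedWins G h, σ i = c := by
  simp [untouchedChoices]

theorem Renaming.mem_untouchedWins (r : Renaming G G') (h : G.History) (σ : G.Profile) :
    r.mapProfile σ ∈ untouchedWins G' (h.map r.mapProfile) ↔ σ ∈ untouchedWins G h := by
  rw [WLCGame.mem_untouchedWins, WLCGame.mem_untouchedWins, r.mapProfile_mem_win]
  simp only [List.mem_map, forall_exists_index, and_imp, forall_apply_eq_imp_iff₂,
    r.mapProfile_apply, ne_eq, EmbeddingLike.apply_eq_iff_eq]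
  refine and_congr_right fun _ => forall₂_congr fun τ _ => ?_
  exact (r.perm.surjective.forall (p := fun j => τ j ≠ σ j)).symm

/-- Each player chooses uniformly from the choices in the untouched winning profiles. -/
def loopAvoidance (n : ℕ) : Protocol n :=
  Protocol.ofWeights (fun i G h => unif (untouchedChoices G h i))
    (fun _ _ _ => unif_nonneg _) (fun _ _ _ => sum_unif _)

theorem loopAvoidance_isStructural (n : ℕ) : (loopAvoidance n).IsStructural := by
  refine Protocol.ofWeights_isStructural fun G G' r h i c => unif_equiv _ (fun c => ?_) c
  rw [mem_untouchedChoices, mem_untouchedChoices, r.mapProfile_surjective.exists]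
  simp only [r.mem_untouchedWins, r.mapProfile_apply, EmbeddingLike.apply_eq_iff_eq]

/-- When winning pairs are disjoint, k untouched pairs give k candidate choices per player and
winning probability at least 1/k. A failure uses choices from two different pairs, so exactly k - 2
remain untouched. -/
theorem loopAvoidance_ectFrom_le {G : WLCGame 2}
    (hG : ∀ σ ∈ G.win, ∀ τ ∈ G.win, ∀ i, σ i = τ i → σ = τ) {h : G.History} {k : ℕ}
    (hk : 0 < k) (hc : (untouchedWins G h).card = k) {C : ℝ} (hC0 : 0 ≤ C)
    (hC : ∀ h' : G.History, (untouchedWins G h').card + 2 = k →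
      (loopAvoidance 2).ectFrom G h' ≤ ENNReal.ofReal C) :
    (loopAvoidance 2).ectFrom G h ≤ ENNReal.ofReal (1 + (1 - 1 / k) * C) := by
  classical
  have hne : (untouchedWins G h).Nonempty := Finset.card_pos.1 (by omega)
  have hcard : ∀ i, (untouchedChoices G h i).card = k := fun i => by
    rw [untouchedChoices, Finset.card_image_of_injOn, hc]
    exact fun σ hσ τ hτ e => hG σ (mem_untouchedWins.1 hσ).1 τ (mem_untouchedWins.1 hτ).1 i e
  have hne' : ∀ i, (untouchedChoices G h i).Nonempty := fun i => Finset.card_pos.1 (by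
    rw [hcard]; exact hk)
  refine (loopAvoidance 2).ectFrom_le_step h C (1 / k) hC0 ?_ fun σ hσ hp => hC _ ?_
  · rw [loopAvoidance, Protocol.winProb_ofWeights, winSum_unif (hne' 0) (hne' 1), hcard, hcard]
    have : k ≤ (Finset.univ.filter fun σ : G.Profile => σ ∈ G.win ∧ σ 0 ∈ untouchedChoices G h 0 ∧
        σ 1 ∈ untouchedChoices G h 1).card := by
      rw [← hc]
      refine Finset.card_le_card fun σ hσ => ?_
      simp only [Finset.mem_filter, Finset.mem_univ, true_and]
      exact ⟨(mem_untouchedWins.1 hσ).1, mem_untouchedChoices.2 ⟨σ, hσ, rfl⟩,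
        mem_untouchedChoices.2 ⟨σ, hσ, rfl⟩⟩
    have hk' : (0 : ℝ) < k := by exact_mod_cast hk
    rw [div_le_div_iff₀ hk' (by positivity), one_mul]
    have : (k : ℝ) ≤ _ := Nat.cast_le.2 this
    nlinarith
  · rw [loopAvoidance, Protocol.ofWeights_prob, Fin.prod_univ_two] at hp
    obtain ⟨ε, hε, e0⟩ := mem_untouchedChoices.1
      (unif_ne_zero (hne' 0) (left_ne_zero_of_mul hp))
    obtain ⟨ε', hε', e1⟩ := mem_untouchedChoices.1
      (unif_ne_zero (hne' 1) (right_ne_zero_of_mul hp))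
    have hεε : ε ≠ ε' := by
      rintro rfl
      exact hσ (profile_ext e0 e1 ▸ (mem_untouchedWins.1 hε).1)
    -- The failing profile takes one choice from the pair ε and one from ε'; by disjointness it
    -- touches no other winning pair.
    have : untouchedWins G (h ++ [σ]) = ((untouchedWins G h).erase ε).erase ε' := by
      ext ρ
      rw [Finset.mem_erase, Finset.mem_erase, mem_untouchedWins]
      constructor
      · rintro ⟨h1, h2⟩
        refine ⟨?_, ?_, mem_untouchedWins.2 ⟨h1, fun τ hτ => h2 τ (by simp [hτ])⟩⟩
        · rintro rfl
          exact h2 σ (by simp) 1 e1.symm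
        · rintro rfl
          exact h2 σ (by simp) 0 e0.symm
      · rintro ⟨h1, h2, h3⟩
        have h4 := mem_untouchedWins.1 h3
        refine ⟨h4.1, fun τ hτ => ?_⟩
        rcases List.mem_append.1 hτ with hτ | hτ
        · exact h4.2 τ hτ
        · rw [List.mem_singleton] at hτ
          subst hτ
          rw [Fin.forall_fin_two]
          exact ⟨fun e => h2 (hG _ h4.1 _ (mem_untouchedWins.1 hε).1 0 (e0.trans e).symm),
            fun e => h1 (hG _ h4.1 _ (mem_untouchedWins.1 hε').1 1 (e1.trans e).symm)⟩
    rw [this, Finset.card_erase_of_mem (Finset.mem_erase.2 ⟨hεε.symm, hε'⟩),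
      Finset.card_erase_of_mem hε, hc]
    have : 1 < (untouchedWins G h).card := Finset.one_lt_card.2 ⟨ε, hε, ε', hε', hεε⟩
    omega

end LoopAvoidance

/-! ### The choice matching game: optimal play for sizes 3 and 5, and the lower bound. -/

section ChoiceMatching

variable {m : ℕ} [NeZero m]

theorem choiceMatching_win {σ : (choiceMatching m).Profile} :
    σ ∈ (choiceMatching m).win ↔ σ 0 = σ 1 := Iff.rfl

theorem pair_mem_choiceMatching_win {x y : Fin m} :
    (pair x y : (choiceMatching m).Profile) ∈ (choiceMatching m).win ↔ x = y := Iff.rfl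

theorem choiceMatching_eq_of_apply_eq (σ : (choiceMatching m).Profile)
    (hσ : σ ∈ (choiceMatching m).win) (τ : (choiceMatching m).Profile)
    (hτ : τ ∈ (choiceMatching m).win) (i : Fin 2) (e : σ i = τ i) : σ = τ := by
  rw [choiceMatching_win] at hσ hτ
  revert i
  rw [Fin.forall_fin_two]
  exact ⟨fun e => profile_ext e (hσ ▸ hτ ▸ e), fun e => profile_ext (hσ.trans (e.trans hτ.symm)) e⟩

theorem card_untouchedWins_choiceMatching :
    (untouchedWins (choiceMatching m) []).card = m := by
  have : untouchedWins (choiceMatching m) [] = Finset.univ.map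
      ⟨fun c : Fin m => (pair c c : (choiceMatching m).Profile), fun c d e => congrFun e 0⟩ := by
    ext σ
    simp only [mem_untouchedWins, choiceMatching_win, List.not_mem_nil, false_imp_iff, implies_true,
      and_true, Finset.mem_map, Finset.mem_univ, true_and]
    exact ⟨fun e => ⟨σ 0, profile_ext rfl e⟩, by rintro ⟨c, rfl⟩; rfl⟩
  rw [this, Finset.card_map]
  simp

/-- The expected coordination time of loop avoidance in the choice matching game of size three. -/
theorem loopAvoidance_ect_three :
    (loopAvoidance 2).ect (choiceMatching 3) ≤ ENNReal.ofReal (5 / 3) := by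
  refine (loopAvoidance_ectFrom_le choiceMatching_eq_of_apply_eq (by norm_num)
    card_untouchedWins_choiceMatching zero_le_one fun h' hh' => ?_).trans
    (ENNReal.ofReal_le_ofReal (by norm_num))
  -- With one untouched pair left no failure can occur, so the hypothesis on later stages is vacuous
  -- and C = 0 is admissible.
  exact (loopAvoidance_ectFrom_le choiceMatching_eq_of_apply_eq one_pos (by omega) le_rfl
    fun h'' hh'' => by omega).trans (ENNReal.ofReal_le_ofReal (by norm_num))

/-- The expected coordination time of loop avoidance in the choice matching game of size five. -/
theorem loopAvoidance_ect_five :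
    (loopAvoidance 2).ect (choiceMatching 5) ≤ ENNReal.ofReal (2 + 1 / 3) := by
  refine (loopAvoidance_ectFrom_le choiceMatching_eq_of_apply_eq (by norm_num)
    card_untouchedWins_choiceMatching (C := 5 / 3) (by norm_num) fun h hh => ?_).trans
    (ENNReal.ofReal_le_ofReal (by norm_num))
  refine (loopAvoidance_ectFrom_le choiceMatching_eq_of_apply_eq (k := 3) (by norm_num)
    (by omega) zero_le_one fun h' hh' => ?_).trans
    (ENNReal.ofReal_le_ofReal (by norm_num))
  exact (loopAvoidance_ectFrom_le choiceMatching_eq_of_apply_eq one_pos (by omega) le_rfl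
    fun h'' hh'' => by omega).trans (ENNReal.ofReal_le_ofReal (by norm_num))

open Classical in
/-- The choices of either player that occur in the history. -/
def touched (h : (choiceMatching m).History) : Finset (Fin m) :=
  Finset.univ.filter fun c => ∃ σ ∈ h, σ 0 = c ∨ σ 1 = c

theorem mem_touched {h : (choiceMatching m).History} {c : Fin m} :
    c ∈ touched h ↔ ∃ σ ∈ h, σ 0 = c ∨ σ 1 = c := by
  simp [touched]

/-- `τ` exchanges the two players in the failing history `h` and fixes the other choices. -/
structure MirrorBy (h : (choiceMatching m).History) (τ : Equiv.Perm (Fin m)) : Prop where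
  involutive : ∀ c, τ (τ c) = c
  fix : ∀ c, c ∉ touched h → τ c = c
  swap : ∀ σ ∈ h, τ (σ 0) = σ 1 ∧ σ 0 ≠ σ 1

theorem MirrorBy.apply_ne {h : (choiceMatching m).History} {τ : Equiv.Perm (Fin m)}
    (hτ : MirrorBy h τ) {c : Fin m} (hc : c ∈ touched h) : τ c ≠ c := by
  obtain ⟨σ, hσ, rfl | rfl⟩ := mem_touched.1 hc
  · rw [(hτ.swap σ hσ).1]; exact (hτ.swap σ hσ).2.symm
  · have := hτ.swap σ hσ
    exact fun e => this.2 ((hτ.involutive _).symm.trans ((congrArg τ this.1).trans e))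

theorem MirrorBy.apply_mem {h : (choiceMatching m).History} {τ : Equiv.Perm (Fin m)}
    (hτ : MirrorBy h τ) {c : Fin m} (hc : c ∈ touched h) : τ c ∈ touched h := by
  by_contra hn
  have := hτ.fix _ hn
  rw [hτ.involutive] at this
  exact hτ.apply_ne hc this.symm

theorem touched_append {h : (choiceMatching m).History} {x y : Fin m} :
    touched (h ++ [pair x y]) = insert x (insert y (touched h)) := by
  ext c
  simp only [mem_touched, List.mem_append, List.mem_singleton, Finset.mem_insert]
  constructor
  · rintro ⟨σ, hσ | rfl, h1⟩
    · exact Or.inr (Or.inr ⟨σ, hσ, h1⟩)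
    · rcases h1 with h1 | h1
      · exact Or.inl h1.symm
      · exact Or.inr (Or.inl h1.symm)
  · rintro (rfl | rfl | ⟨σ, hσ, h1⟩)
    · exact ⟨_, Or.inr rfl, Or.inl rfl⟩
    · exact ⟨_, Or.inr rfl, Or.inr rfl⟩
    · exact ⟨σ, Or.inl hσ, h1⟩

theorem MirrorBy.append_touched {h : (choiceMatching m).History} {τ : Equiv.Perm (Fin m)}
    (hτ : MirrorBy h τ) {x : Fin m} (hx : x ∈ touched h) :
    MirrorBy (h ++ [pair x (τ x)]) τ ∧ touched (h ++ [pair x (τ x)]) = touched h := by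
  have ht : touched (h ++ [pair x (τ x)]) = touched h := by
    rw [touched_append, Finset.insert_eq_of_mem (hτ.apply_mem hx), Finset.insert_eq_of_mem hx]
  refine ⟨⟨hτ.involutive, by rw [ht]; exact hτ.fix, fun σ hσ => ?_⟩, ht⟩
  rcases List.mem_append.1 hσ with hσ | hσ
  · exact hτ.swap σ hσ
  · rw [List.mem_singleton] at hσ
    subst hσ
    exact ⟨rfl, (hτ.apply_ne hx).symm⟩

/-- The old involution fixes x and y, so it commutes with their transposition, and the product
mirrors the new round as well. -/
theorem MirrorBy.append_untouched {h : (choiceMatching m).History} {τ : Equiv.Perm (Fin m)}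
    (hτ : MirrorBy h τ) {x y : Fin m} (hx : x ∉ touched h) (hy : y ∉ touched h) (hxy : x ≠ y) :
    MirrorBy (h ++ [pair x y]) (τ * Equiv.swap x y) ∧
      (touched (h ++ [pair x y])).card = (touched h).card + 2 := by
  have hsw : ∀ c, c ≠ x → c ≠ y → (τ * Equiv.swap x y) c = τ c := fun c h1 h2 => by
    rw [Equiv.Perm.mul_apply, Equiv.swap_apply_of_ne_of_ne h1 h2]
  have hsx : (τ * Equiv.swap x y) x = y := by
    rw [Equiv.Perm.mul_apply, Equiv.swap_apply_left, hτ.fix y hy]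
  have hsy : (τ * Equiv.swap x y) y = x := by
    rw [Equiv.Perm.mul_apply, Equiv.swap_apply_right, hτ.fix x hx]
  have hτx : ∀ c, c ≠ x → τ c ≠ x := fun c hc e => hc (by
    rw [← hτ.involutive c, e, hτ.fix x hx])
  have hτy : ∀ c, c ≠ y → τ c ≠ y := fun c hc e => hc (by
    rw [← hτ.involutive c, e, hτ.fix y hy])
  refine ⟨⟨fun c => ?_, fun c hc => ?_, fun σ hσ => ?_⟩, ?_⟩
  · by_cases h1 : c = x
    · rw [h1, hsx, hsy]
    by_cases h2 : c = y
    · rw [h2, hsy, hsx]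
    rw [hsw c h1 h2, hsw _ (hτx c h1) (hτy c h2), hτ.involutive]
  · rw [touched_append] at hc
    simp only [Finset.mem_insert, not_or] at hc
    rw [hsw c hc.1 hc.2.1, hτ.fix c hc.2.2]
  · rcases List.mem_append.1 hσ with hσ | hσ
    · have h0 : σ 0 ∈ touched h := mem_touched.2 ⟨σ, hσ, Or.inl rfl⟩
      refine ⟨?_, (hτ.swap σ hσ).2⟩
      rw [hsw _ (fun e => hx (e ▸ h0)) (fun e => hy (e ▸ h0))]
      exact (hτ.swap σ hσ).1
    · rw [List.mem_singleton] at hσ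
      subst hσ
      exact ⟨hsx, hxy⟩
  · rw [touched_append, Finset.card_insert_of_notMem (by simp [hxy, hx]),
      Finset.card_insert_of_notMem hy]

/-- The renaming of a choice matching game given by a permutation of the players and a
permutation of the choices. -/
def choiceMatchingRenaming (p : Equiv.Perm (Fin 2)) (ρ : Equiv.Perm (Fin m)) :
    Renaming (choiceMatching m) (choiceMatching m) where
  perm := p
  equiv := fun _ => ρ
  win_iff := fun σ => by
    rw [choiceMatching_win, choiceMatching_win]
    refine Iff.trans ?_ ρ.injective.eq_iff.symm
    have hp : (p 0 = 0 ∧ p 1 = 1) ∨ (p 0 = 1 ∧ p 1 = 0) := by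
      have : p 0 ≠ p 1 := fun e => zero_ne_one (p.injective e)
      omega
    rcases hp with ⟨e0, e1⟩ | ⟨e0, e1⟩
    · rw [e0, e1]; exact Iff.rfl
    · rw [e0, e1]; exact eq_comm

/-- Exchanging the players and applying τ is a renaming that fixes the history. -/
theorem Protocol.IsStructural.eq_of_mirrorBy {π : Protocol 2} (hπ : π.IsStructural)
    {h : (choiceMatching m).History} {τ : Equiv.Perm (Fin m)} (hτ : MirrorBy h τ) (c : Fin m) :
    π 0 (choiceMatching m) h c = π 1 (choiceMatching m) h (τ c) := by
  refine hπ _ _ h h (choiceMatchingRenaming (Equiv.swap 0 1) τ) ?_ 1 c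
  refine (List.map_id h).symm.trans (List.map_congr_left fun σ hσ => ?_)
  have := (hτ.swap σ hσ).1
  exact profile_ext ((hτ.involutive _).symm.trans (congrArg τ this)) this.symm

/-- Transposing two untouched choices fixes the history. -/
theorem Protocol.IsStructural.eq_of_untouched {π : Protocol 2} (hπ : π.IsStructural)
    {h : (choiceMatching m).History} {x y : Fin m} (hx : x ∉ touched h) (hy : y ∉ touched h) :
    π 0 (choiceMatching m) h x = π 0 (choiceMatching m) h y := by
  have := hπ _ _ h h (choiceMatchingRenaming (Equiv.refl _) (Equiv.swap x y)) ?_ 0 x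
  · exact this.trans (congrArg _ (Equiv.swap_apply_left x y))
  refine (List.map_id h).symm.trans (List.map_congr_left fun σ hσ => ?_)
  have key : ∀ c ∈ touched h, Equiv.swap x y c = c := fun c hc =>
    Equiv.swap_apply_of_ne_of_ne (fun e => hx (e ▸ hc)) fun e => hy (e ▸ hc)
  exact profile_ext (key _ (mem_touched.2 ⟨σ, hσ, Or.inl rfl⟩)).symm
    (key _ (mem_touched.2 ⟨σ, hσ, Or.inr rfl⟩)).symm

/-- The optimal expected coordination time of a mirrored failing stage of a choice matching game
with `n` untouched choices. -/
def mirrorValue (n : ℕ) : ℝ := if n = 1 then 1 else if n = 3 then 5 / 3 else 2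

theorem one_le_mirrorValue (n : ℕ) : 1 ≤ mirrorValue n := by
  unfold mirrorValue; split_ifs <;> norm_num

theorem mirrorValue_le_two (n : ℕ) : mirrorValue n ≤ 2 := by
  unfold mirrorValue; split_ifs <;> norm_num

/-- M is the mass on touched choices, Q the sum of its squared weights, ρ the weight of each of the
n untouched choices. For n = 1 and n = 3 the claim reduces to Q + ρ² ≤ 1 and Q + 9ρ² ≤ 1, which
follow from M + nρ = 1. For other n the value 2 cancels the loss Q, and the gain from distinct
untouched pairs covers nρ². -/
theorem mirrorValue_le (n : ℕ) {M Q ρ : ℝ} (hM : 0 ≤ M) (hρ : 0 ≤ ρ) (hQM : Q ≤ M ^ 2)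
    (hsum : M + n * ρ = 1) :
    mirrorValue n ≤ 2 - Q - n * ρ ^ 2 + (mirrorValue n - 1) * Q +
      (mirrorValue (n - 2) - 1) * (n * (n - 1) * ρ ^ 2) := by
  have h2 := sq_nonneg ρ
  rcases n with _ | _ | _ | _ | _ | _ | n
  · simp [mirrorValue]; linarith
  · simp [mirrorValue] at *
    nlinarith [mul_nonneg hM hρ]
  · simp [mirrorValue] at *; linarith
  · simp [mirrorValue] at *
    nlinarith [mul_nonneg hM hρ]
  · simp [mirrorValue] at *; linarith
  · simp [mirrorValue] at *; linarith
  · have e1 : mirrorValue (n + 6) = 2 := by simp [mirrorValue]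
    have e2 : mirrorValue (n + 6 - 2) = 2 := by
      rw [mirrorValue, if_neg (by omega), if_neg (by omega)]
    simp only [show n + 1 + 1 + 1 + 1 + 1 + 1 = n + 6 by ring]
    rw [e1, e2]
    push_cast
    have : (0 : ℝ) ≤ n := Nat.cast_nonneg n
    nlinarith [mul_nonneg (mul_nonneg this this) h2, mul_nonneg this h2]

/-- The one-step lower bound in a mirrored stage with values `v` and `v'` of the mirrored stages with
as many and with two less untouched choices. -/
theorem Protocol.IsStructural.one_step_le {π : Protocol 2} (hπ : π.IsStructural)
    {h : (choiceMatching m).History} {τ : Equiv.Perm (Fin m)} (hτ : MirrorBy h τ)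
    {F : (choiceMatching m).History → ℝ} {v v' : ℝ} (hF : ∀ σ, 1 ≤ F (h ++ [σ]))
    (hv : ∀ x ∈ touched h, v ≤ F (h ++ [pair x (τ x)]))
    (hv' : ∀ x y, x ∉ touched h → y ∉ touched h → x ≠ y → v' ≤ F (h ++ [pair x y])) :
    ∃ M Q ρ : ℝ, 0 ≤ M ∧ 0 ≤ ρ ∧ Q ≤ M ^ 2 ∧ M + (touched h)ᶜ.card * ρ = 1 ∧
      (touched h = ∅ → M = 0 ∧ Q = 0) ∧
      2 - Q - (touched h)ᶜ.card * ρ ^ 2 + (v - 1) * Q +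
        (v' - 1) * ((touched h)ᶜ.card * ((touched h)ᶜ.card - 1) * ρ ^ 2) ≤
      1 + ∑ σ, open Classical in if σ ∈ (choiceMatching m).win then 0 else
        π.prob (choiceMatching m) h σ * F (h ++ [σ]) := by
  classical
  set μ : Fin m → ℝ := fun c => (π 0 (choiceMatching m) h c).toReal with hμ
  have μ0 : ∀ c, 0 ≤ μ c := fun c => ENNReal.toReal_nonneg
  have μsum : ∑ c, μ c = 1 := sum_toReal_pmf _
  obtain ⟨ρ, ρ0, hρ⟩ : ∃ ρ : ℝ, 0 ≤ ρ ∧ ∀ c ∈ (touched h)ᶜ, μ c = ρ := by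
    rcases ((touched h)ᶜ).eq_empty_or_nonempty with he | ⟨d, hd⟩
    · exact ⟨0, le_rfl, by simp [he]⟩
    · refine ⟨μ d, μ0 d, fun c hc => congrArg ENNReal.toReal (hπ.eq_of_untouched ?_ ?_)⟩
      · simpa using hc
      · simpa using hd
  -- By mirroring, the second player's weight of y is μ (τ y).
  have hprob : ∀ x y : Fin m, π.prob (choiceMatching m) h (pair x y) = μ x * μ (τ y) := by
    intro x y
    rw [Protocol.prob, Fin.prod_univ_two]
    have := hπ.eq_of_mirrorBy hτ (τ y)
    rw [hτ.involutive] at this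
    exact congrArg (fun t => μ x * ENNReal.toReal t) this.symm
  have split : ∀ f : Fin m → ℝ, ∑ c, f c = ∑ c ∈ touched h, f c + ∑ c ∈ (touched h)ᶜ, f c :=
    fun f => (Finset.sum_add_sum_compl _ _).symm
  have sumU : ∀ f : ℝ → ℝ, ∑ c ∈ (touched h)ᶜ, f (μ c) = (touched h)ᶜ.card * f ρ := by
    intro f
    rw [Finset.sum_congr rfl fun c hc => by rw [hρ c hc], Finset.sum_const, nsmul_eq_mul]
  refine ⟨∑ c ∈ touched h, μ c, ∑ c ∈ touched h, μ c ^ 2, ρ, Finset.sum_nonneg fun c _ => μ0 c, ρ0,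
    Finset.sum_sq_le_sq_sum_of_nonneg fun c _ => μ0 c, ?_, ?_, ?_⟩
  · rw [← μsum, split, sumU fun t => t]
  · intro he
    simp [he]
  -- Each failure counts 1, with a surplus v - 1 on mirrored touched pairs and v' - 1 on pairs of
  -- distinct untouched choices; the last term removes the diagonal from the untouched square.
  have key : ∀ x y : Fin m, μ x * μ (τ y) - (if x = y then μ x * μ (τ x) else 0) +
      (if y = τ x then if x ∈ touched h then (v - 1) * μ x ^ 2 else 0 else 0) +
      (if x ∈ (touched h)ᶜ then if y ∈ (touched h)ᶜ then (v' - 1) * ρ ^ 2 else 0 else 0) -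
      (if x = y then if x ∈ (touched h)ᶜ then (v' - 1) * ρ ^ 2 else 0 else 0) ≤
      if (pair x y : (choiceMatching m).Profile) ∈ (choiceMatching m).win then 0 else
        π.prob (choiceMatching m) h (pair x y) * F (h ++ [pair x y]) := by
    intro x y
    simp only [pair_mem_choiceMatching_win, hprob, Finset.mem_compl]
    by_cases hxy : x = y
    · subst hxy
      by_cases hx : x ∈ touched h
      · simp [hx, (hτ.apply_ne hx).symm]
      · simp [hx]
    · have hnn := mul_nonneg (μ0 x) (μ0 (τ y))
      have h1 := mul_le_mul_of_nonneg_left (hF (pair x y)) hnn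
      by_cases hx : x ∈ touched h
      · by_cases hyx : y = τ x
        · subst hyx
          have h2 := mul_le_mul_of_nonneg_left (hv x hx) hnn
          simp only [hτ.involutive] at *
          simp [hxy, hx]
          linarith
        · simp [hxy, hx, hyx]
          linarith
      · by_cases hy : y ∈ touched h
        · simp [hxy, hx, hy]
          linarith
        · have h2 := mul_le_mul_of_nonneg_left (hv' x y hx hy hxy) hnn
          rw [hτ.fix y hy, hρ x (by simpa using hx), hρ y (by simpa using hy)] at *
          simp [hxy, hx, hy]
          linarith
  rw [sum_profile]
  have total := Finset.sum_le_sum fun x (_ : x ∈ Finset.univ) =>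
    Finset.sum_le_sum fun y (_ : y ∈ Finset.univ) => key x y
  refine le_trans ?_ (add_le_add_right total 1)
  simp only [Finset.sum_add_distrib, Finset.sum_sub_distrib, Finset.sum_ite_eq, Finset.mem_univ,
    if_true, Finset.sum_ite_eq']
  have e1 : ∑ x, ∑ y, μ x * μ (τ y) = 1 := by
    rw [← Finset.sum_mul_sum, Equiv.sum_comp τ μ, μsum, one_mul]
  -- The left side is the winning probability. A permutation preserves the sum of squares, so
  -- Cauchy–Schwarz applies.
  have e2 : ∑ x, μ x * μ (τ x) ≤ ∑ x, μ x ^ 2 := by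
    have h1 : ∑ x, μ (τ x) ^ 2 = ∑ x, μ x ^ 2 := Equiv.sum_comp τ fun x => μ x ^ 2
    have h2 : 0 ≤ ∑ x, (μ x - μ (τ x)) ^ 2 := Finset.sum_nonneg fun x _ => sq_nonneg _
    have h3 : ∑ x, (μ x - μ (τ x)) ^ 2 =
        ∑ x, μ x ^ 2 + ∑ x, μ (τ x) ^ 2 - 2 * ∑ x, μ x * μ (τ x) := by
      rw [Finset.mul_sum, ← Finset.sum_add_distrib, ← Finset.sum_sub_distrib]
      exact Finset.sum_congr rfl fun x _ => by ring
    linarith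
  have e3 : ∑ x, μ x ^ 2 = ∑ x ∈ touched h, μ x ^ 2 + (touched h)ᶜ.card * ρ ^ 2 := by
    rw [split, sumU fun t => t ^ 2]
  have e4 : ∑ x, (if x ∈ touched h then (v - 1) * μ x ^ 2 else 0) =
      (v - 1) * ∑ x ∈ touched h, μ x ^ 2 := by
    rw [← Finset.sum_filter, Finset.mul_sum]
    simp
  have e5 : ∑ x, ∑ y, (if x ∈ (touched h)ᶜ then if y ∈ (touched h)ᶜ then (v' - 1) * ρ ^ 2 else 0
      else 0) = (touched h)ᶜ.card * ((touched h)ᶜ.card * ((v' - 1) * ρ ^ 2)) := by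
    have : ∀ x, ∑ y, (if x ∈ (touched h)ᶜ then if y ∈ (touched h)ᶜ then (v' - 1) * ρ ^ 2 else 0
        else 0) = if x ∈ (touched h)ᶜ then (touched h)ᶜ.card * ((v' - 1) * ρ ^ 2) else 0 := by
      intro x
      by_cases hx : x ∈ (touched h)ᶜ
      · simp only [if_pos hx, Finset.sum_ite_mem, Finset.univ_inter, Finset.sum_const, nsmul_eq_mul]
      · simp only [if_neg hx, Finset.sum_const_zero]
    simp only [this, Finset.sum_ite_mem, Finset.univ_inter, Finset.sum_const, nsmul_eq_mul]
  have e6 : ∑ x, (if x ∈ (touched h)ᶜ then (v' - 1) * ρ ^ 2 else 0) =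
      (touched h)ᶜ.card * ((v' - 1) * ρ ^ 2) := by
    simp only [Finset.sum_ite_mem, Finset.univ_inter, Finset.sum_const, nsmul_eq_mul]
  rw [e1, e4, e5, e6]
  linarith

open Classical in
/-- A lower bound of the expected coordination time in the stages of the choice matching game. -/
def matchingBound (h : (choiceMatching m).History) : ℝ :=
  if h = [] then 1 + (m - 1) / m * mirrorValue (m - 2)
  else if ∃ τ, MirrorBy h τ then mirrorValue (touched h)ᶜ.card else 1

theorem one_le_matchingBound_append (h : (choiceMatching m).History)
    (σ : (choiceMatching m).Profile) : 1 ≤ matchingBound (h ++ [σ]) := by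
  rw [matchingBound, if_neg (by simp)]
  split_ifs
  · exact one_le_mirrorValue _
  · exact le_rfl

theorem matchingBound_append_of_mirrorBy {h : (choiceMatching m).History}
    {σ : (choiceMatching m).Profile} {τ : Equiv.Perm (Fin m)} (hτ : MirrorBy (h ++ [σ]) τ) :
    matchingBound (h ++ [σ]) = mirrorValue (touched (h ++ [σ]))ᶜ.card := by
  rw [matchingBound, if_neg (by simp), if_pos ⟨τ, hτ⟩]

/-- In mirrored stages this is the recursion for `mirrorValue`. The empty history is treated
separately because nothing is touched yet and both players are forced to play uniformly. Once the
mirror symmetry is lost, the trivial bound 1 suffices. -/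
theorem Protocol.IsStructural.matchingBound_le {π : Protocol 2} (hπ : π.IsStructural)
    (h : (choiceMatching m).History) : matchingBound h ≤ 1 + ∑ σ, open Classical in
      if σ ∈ (choiceMatching m).win then 0 else
        π.prob (choiceMatching m) h σ * matchingBound (h ++ [σ]) := by
  classical
  by_cases hs : ∃ τ, MirrorBy h τ
  · obtain ⟨τ, hτ⟩ := hs
    obtain ⟨M, Q, ρ, hM, hρ, hQ, hsum, hempty, hle⟩ := hπ.one_step_le hτ
      (one_le_matchingBound_append h) (v := mirrorValue (touched h)ᶜ.card)
      (v' := mirrorValue ((touched h)ᶜ.card - 2))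
      (fun x hx => by
        have := hτ.append_touched hx
        rw [matchingBound_append_of_mirrorBy this.1, this.2])
      (fun x y hx hy hxy => by
        have := hτ.append_untouched hx hy hxy
        rw [matchingBound_append_of_mirrorBy this.1, Finset.card_compl, Finset.card_compl, this.2,
          Nat.sub_sub])
    refine le_trans ?_ hle
    by_cases hh : h = []
    · subst hh
      have ht : touched ([] : (choiceMatching m).History) = ∅ := by
        ext c; simp [mem_touched]
      -- With no touched mass, ρ = 1/m, and the bound holds with equality.
      obtain ⟨rfl, rfl⟩ := hempty ht
      rw [ht] at hsum ⊢
      simp only [Finset.compl_empty, Finset.card_univ, Fintype.card_fin] at hsum ⊢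
      have hm : (m : ℝ) ≠ 0 := Nat.cast_ne_zero.2 (NeZero.ne m)
      have : ρ = 1 / m := by field_simp; linarith
      rw [matchingBound, if_pos rfl, this]
      apply le_of_eq
      field_simp
      ring
    · rw [matchingBound, if_neg hh, if_pos ⟨τ, hτ⟩]
      exact mirrorValue_le _ hM hρ hQ hsum
  · have hh : h ≠ [] := by
      rintro rfl
      exact hs ⟨1, fun c => rfl, fun c _ => rfl, by simp⟩
    rw [matchingBound, if_neg hh, if_neg hs]
    refine le_add_of_nonneg_right (Finset.sum_nonneg fun σ _ => ?_)
    split_ifs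
    · exact le_rfl
    · exact mul_nonneg (π.prob_nonneg h σ) (zero_le_one.trans (one_le_matchingBound_append h σ))

theorem Protocol.IsStructural.le_ect_choiceMatching {π : Protocol 2} (hπ : π.IsStructural) :
    ENNReal.ofReal (1 + (m - 1) / m * mirrorValue (m - 2)) ≤ π.ect (choiceMatching m) := by
  have h1 : ((m : ℝ) - 1) / m ≤ 1 := by
    rw [div_le_one (Nat.cast_pos.2 (NeZero.pos m))]
    linarith
  have := π.le_ectFrom (matchingBound (m := m)) 3 (fun h => ?_) hπ.matchingBound_le []
  · rwa [matchingBound, if_pos rfl] at this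
  rw [matchingBound]
  have h2 := mirrorValue_le_two (m - 2)
  have h3 := one_le_mirrorValue (m - 2)
  split_ifs
  · nlinarith
  · linarith [mirrorValue_le_two (touched h)ᶜ.card]
  · norm_num

end ChoiceMatching

/-! ### Renaming-invariant families of choices, built from degrees. -/

section Families

variable {n : ℕ} {G G' : WLCGame n}

open Classical in
/-- The number of winning profiles. -/
def numWins (G : WLCGame n) : ℕ := (Finset.univ.filter fun σ : G.Profile => σ ∈ G.win).card

open Classical in
/-- The number of winning profiles in which player `i` chooses `c`. -/
def deg (G : WLCGame n) (i : Fin n) (c : G.Choice i) : ℕ :=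
  (Finset.univ.filter fun σ : G.Profile => σ ∈ G.win ∧ σ i = c).card

theorem deg_pos (i : Fin n) (c : G.Choice i) : 1 ≤ G.deg i c := by
  obtain ⟨σ, hσ, e⟩ := G.exists_win i c
  exact Finset.card_pos.2 ⟨σ, by simp [hσ, e]⟩

theorem sum_deg (G : WLCGame n) (i : Fin n) : ∑ c, G.deg i c = G.numWins := by
  classical
  rw [numWins, Finset.card_eq_sum_card_fiberwise (f := fun σ => σ i) (t := Finset.univ) (by simp)]
  refine Finset.sum_congr rfl fun c _ => ?_
  rw [deg, Finset.filter_filter]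

theorem card_choice_le_numWins (G : WLCGame n) (i : Fin n) :
    Fintype.card (G.Choice i) ≤ G.numWins := by
  rw [← sum_deg G i, ← Finset.card_univ, Finset.card_eq_sum_ones]
  exact Finset.sum_le_sum fun c _ => deg_pos i c

theorem Renaming.deg_eq (r : Renaming G G') (i : Fin n) (c : G.Choice (r.perm i)) :
    G'.deg i (r.equiv i c) = G.deg (r.perm i) c := by
  refine (Finset.card_equiv r.profileEquiv fun σ => ?_).symm
  simp [r.profileEquiv_apply, r.mapProfile_mem_win, r.mapProfile_apply]

theorem eq_of_deg_eq_one {i : Fin n} {σ τ : G.Profile} (hσ : σ ∈ G.win) (hτ : τ ∈ G.win)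
    (e : σ i = τ i) (h : G.deg i (σ i) = 1) : σ = τ :=
  Finset.card_le_one.1 h.le σ (by simp [hσ]) τ (by simp [hτ, e])

open Classical in
/-- The choices of degree `d` of the players with `s` choices. -/
def degFamily (n s d : ℕ) : Family n := fun G i =>
  Finset.univ.filter fun c => Fintype.card (G.Choice i) = s ∧ G.deg i c = d

open Classical in
/-- The choices in the winning profiles in which some other player makes a choice from `A`. -/
def nbrFamily (A : Family n) : Family n := fun G i =>
  Finset.univ.filter fun c => ∃ σ ∈ G.win, σ i = c ∧ ∃ j, j ≠ i ∧ σ j ∈ A G j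

open Classical in
/-- The choices in the winning profiles all of whose choices have degree `d`. -/
def coreFamily (n d : ℕ) : Family n := fun G i =>
  Finset.univ.filter fun c => ∃ σ ∈ G.win, σ i = c ∧ ∀ j, G.deg j (σ j) = d

open Classical in
/-- The family `A`, and the family `B` for the players for which `A` is empty. -/
def Family.orElse (A B : Family n) : Family n := fun G i =>
  if (A G i).Nonempty then A G i else B G i

theorem mem_degFamily {s d : ℕ} {i : Fin n} {c : G.Choice i} :
    c ∈ degFamily n s d G i ↔ Fintype.card (G.Choice i) = s ∧ G.deg i c = d := by
  simp [degFamily]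

theorem mem_nbrFamily {A : Family n} {i : Fin n} {c : G.Choice i} :
    c ∈ nbrFamily A G i ↔ ∃ σ ∈ G.win, σ i = c ∧ ∃ j, j ≠ i ∧ σ j ∈ A G j := by
  simp [nbrFamily]

theorem mem_coreFamily {d : ℕ} {i : Fin n} {c : G.Choice i} :
    c ∈ coreFamily n d G i ↔ ∃ σ ∈ G.win, σ i = c ∧ ∀ j, G.deg j (σ j) = d := by
  simp [coreFamily]

theorem univ_isInvariant : Family.IsInvariant fun (_ : WLCGame n) _ => Finset.univ := by
  simp [Family.IsInvariant]

theorem degFamily_isInvariant (n s d : ℕ) : (degFamily n s d).IsInvariant := by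
  intro G G' r i c
  rw [mem_degFamily, mem_degFamily, r.deg_eq, Fintype.card_congr (r.equiv i)]

theorem nbrFamily_isInvariant {A : Family n} (hA : A.IsInvariant) :
    (nbrFamily A).IsInvariant := by
  intro G G' r i c
  rw [mem_nbrFamily, mem_nbrFamily, r.mapProfile_surjective.exists]
  refine exists_congr fun σ => ?_
  rw [r.mapProfile_mem_win, r.mapProfile_apply, (r.equiv i).apply_eq_iff_eq,
    r.perm.surjective.exists]
  simp only [r.mapProfile_apply, ← hA G G' r, ne_eq, EmbeddingLike.apply_eq_iff_eq]

theorem coreFamily_isInvariant (n d : ℕ) : (coreFamily n d).IsInvariant := by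
  intro G G' r i c
  rw [mem_coreFamily, mem_coreFamily, r.mapProfile_surjective.exists]
  refine exists_congr fun σ => ?_
  rw [r.mapProfile_mem_win, r.mapProfile_apply, (r.equiv i).apply_eq_iff_eq,
    r.perm.surjective.forall]
  simp only [r.mapProfile_apply, r.deg_eq]

theorem Family.IsInvariant.orElse {A B : Family n} (hA : A.IsInvariant) (hB : B.IsInvariant) :
    (A.orElse B).IsInvariant := by
  intro G G' r i c
  have : (A G (r.perm i)).Nonempty ↔ (A G' i).Nonempty := by
    rw [Finset.Nonempty, Finset.Nonempty, (r.equiv i).surjective.exists]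
    exact exists_congr fun c => hA G G' r i c
  simp only [Family.orElse, this]
  split_ifs
  · exact hA G G' r i c
  · exact hB G G' r i c

end Families

/-! ### Upper bounds from distinguished choices; the bound 3 - 2/m. -/

section UpperBounds

variable {G : WLCGame 2}

theorem winSum_unif_eq_one {S : Finset (G.Choice 0)} {T : Finset (G.Choice 1)} (hS : S.Nonempty)
    (hT : T.Nonempty) (h : ∀ σ : G.Profile, σ 0 ∈ S → σ 1 ∈ T → σ ∈ G.win) :
    winSum G (unif S) (unif T) = 1 :=
  winSum_eq_one (sum_unif _) (sum_unif _) fun σ h0 h1 =>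
    h σ (unif_ne_zero hS h0) (unif_ne_zero hT h1)

theorem mem_win_of_mem_nbrFamily {A : Family 2} {i j : Fin 2} (hij : i ≠ j) {a : G.Choice i}
    (ha : A G i = {a}) {σ : G.Profile} (hi : σ i = a) (hj : σ j ∈ nbrFamily A G j) :
    σ ∈ G.win := by
  obtain ⟨τ, hτ, e, k, hk, hkA⟩ := mem_nbrFamily.1 hj
  have : k = i := by omega
  subst this
  rw [ha, Finset.mem_singleton] at hkA
  convert hτ
  ext l
  have : l = k ∨ l = j := by omega
  rcases this with rfl | rfl
  · rw [hi, hkA]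
  · exact e.symm

theorem nbrFamily_nonempty {A : Family 2} {i j : Fin 2} (hij : i ≠ j) {a : G.Choice i}
    (ha : a ∈ A G i) : (nbrFamily A G j).Nonempty := by
  obtain ⟨τ, hτ, e⟩ := G.exists_win i a
  exact ⟨τ j, mem_nbrFamily.2 ⟨τ, hτ, rfl, i, hij, e.symm ▸ ha⟩⟩

/-- A distinguished choice of exactly one of the players allows for immediate coordination. -/
theorem exists_ect_le_one {A : Family 2} (hA : A.IsInvariant) {i j : Fin 2} (hij : i ≠ j)
    (hi : (A G i).card = 1) (hj : A G j = ∅) :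
    ∃ π : Protocol 2, π.IsStructural ∧ π.ect G ≤ ENNReal.ofReal 1 := by
  obtain ⟨a, ha⟩ := Finset.card_eq_one.1 hi
  -- Player i plays the distinguished choice; player j, who has none, plays a neighbour of it.
  have h1 : A.orElse (nbrFamily A) G i = A G i := by
    rw [Family.orElse, if_pos (by simp [ha])]
  have h2 : A.orElse (nbrFamily A) G j = nbrFamily A G j := by
    rw [Family.orElse, if_neg (by simp [hj])]
  have h3 : (nbrFamily A G j).Nonempty := nbrFamily_nonempty hij (a := a) (by simp [ha])
  obtain ⟨π, hπ, h⟩ := exists_ect_le_of_family (hA.orElse (nbrFamily_isInvariant hA)) (G := G)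
    (p := 1) (by
      have : (i = 0 ∧ j = 1) ∨ (i = 1 ∧ j = 0) := by omega
      rcases this with ⟨rfl, rfl⟩ | ⟨rfl, rfl⟩
      · rw [h1, h2, winSum_unif_eq_one (by simp [ha]) h3 fun σ h4 h5 =>
          mem_win_of_mem_nbrFamily hij ha (by simpa [ha] using h4) h5]
      · rw [h1, h2, winSum_unif_eq_one h3 (by simp [ha]) fun σ h4 h5 =>
          mem_win_of_mem_nbrFamily hij ha (by simpa [ha] using h5) h4])
  exact ⟨π, hπ, h.trans (ENNReal.ofReal_le_ofReal (by norm_num))⟩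

/-- With a distinguished choice of some player, the expected coordination time is at most two. -/
theorem exists_ect_le_two {A : Family 2} (hA : A.IsInvariant) (h1 : ∀ i, (A G i).card ≤ 1)
    (h2 : ∃ i, (A G i).Nonempty) :
    ∃ π : Protocol 2, π.IsStructural ∧ π.ect G ≤ ENNReal.ofReal 2 := by
  obtain ⟨i, hi⟩ := h2
  have hc : ∀ i, A G i = ∅ ∨ (A G i).card = 1 := fun i => by
    have := h1 i
    rw [← Finset.card_eq_zero]
    omega
  obtain ⟨j, hj⟩ : ∃ j : Fin 2, j ≠ i := exists_ne i
  rcases hc j with h | hcj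
  · obtain ⟨π, hπ, h⟩ := exists_ect_le_one hA hj.symm ((hc i).resolve_left hi.ne_empty) h
    exact ⟨π, hπ, h.trans (ENNReal.ofReal_le_ofReal (by norm_num))⟩
  have hone : ∀ k, (A G k).card = 1 := by
    intro k
    have : k = i ∨ k = j := by omega
    rcases this with rfl | rfl
    · exact (hc k).resolve_left hi.ne_empty
    · exact hcj
  obtain ⟨a, ha⟩ := Finset.card_eq_one.1 (hone 0)
  obtain ⟨b, hb⟩ := Finset.card_eq_one.1 (hone 1)
  -- Both players have a distinguished choice: each tosses a coin between the own one and a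
  -- neighbour of the opponent's. Different outcomes surely win.
  refine exists_ect_le_of_families hA (nbrFamily_isInvariant hA) ?_ ?_
  · exact winSum_unif_eq_one (by simp [ha]) (nbrFamily_nonempty zero_ne_one (a := a) (by simp [ha]))
      fun σ h4 h5 => mem_win_of_mem_nbrFamily zero_ne_one ha (by simpa [ha] using h4) h5
  · exact winSum_unif_eq_one (nbrFamily_nonempty one_ne_zero (a := b) (by simp [hb])) (by simp [hb])
      fun σ h4 h5 => mem_win_of_mem_nbrFamily one_ne_zero hb (by simpa [hb] using h5) h4

theorem exists_ect_lt_of_family {A : Family 2} (hA : A.IsInvariant) {θ : ℝ} (hθ : 0 < θ)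
    (h : 3 - 2 * winSum G (unif (A G 0)) (unif (A G 1)) < θ) :
    ∃ π : Protocol 2, π.IsStructural ∧ π.ect G < ENNReal.ofReal θ := by
  obtain ⟨π, hπ, h1⟩ := exists_ect_le_of_family hA (G := G) le_rfl
  exact ⟨π, hπ, h1.trans_lt ((ENNReal.ofReal_lt_ofReal_iff hθ).2 (by linarith))⟩

theorem exists_ect_lt_of_le {t θ : ℝ} (hθ : 0 < θ) (ht : t < θ)
    (h : ∃ π : Protocol 2, π.IsStructural ∧ π.ect G ≤ ENNReal.ofReal t) :
    ∃ π : Protocol 2, π.IsStructural ∧ π.ect G < ENNReal.ofReal θ := by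
  obtain ⟨π, hπ, h⟩ := h
  exact ⟨π, hπ, h.trans_lt ((ENNReal.ofReal_lt_ofReal_iff hθ).2 ht)⟩

theorem winSum_unif_univ (G : WLCGame 2) :
    winSum G (unif Finset.univ) (unif Finset.univ) =
      G.numWins / ((Fintype.card (G.Choice 0) : ℝ) * Fintype.card (G.Choice 1)) := by
  classical
  rw [winSum_unif Finset.univ_nonempty Finset.univ_nonempty, numWins, Finset.card_univ,
    Finset.card_univ]
  congr 3
  ext σ
  simp

/-- The wait-or-move bound for games of size `m`. -/
theorem exists_ect_le_of_mem_choiceGames {m : ℕ} (hG : G ∈ choiceGames m) :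
    ∃ π : Protocol 2, π.IsStructural ∧ π.ect G ≤ ENNReal.ofReal (3 - 2 / m) := by
  have hm : max (Fintype.card (G.Choice 0)) (Fintype.card (G.Choice 1)) = m := hG
  have h0 := card_choice_le_numWins G 0
  have h1 := card_choice_le_numWins G 1
  have p0 : 0 < Fintype.card (G.Choice 0) := Fintype.card_pos
  have p1 : 0 < Fintype.card (G.Choice 1) := Fintype.card_pos
  obtain ⟨π, hπ, h⟩ := exists_ect_le_of_family univ_isInvariant (G := G) (p := 1 / m) (by
    rw [winSum_unif_univ, div_le_div_iff₀ (by exact_mod_cast (by omega : 0 < m))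
      (by exact_mod_cast Nat.mul_pos p0 p1)]
    have : Fintype.card (G.Choice 0) * Fintype.card (G.Choice 1) ≤ G.numWins * m := by
      rcases max_choice (Fintype.card (G.Choice 0)) (Fintype.card (G.Choice 1)) with e | e
      · rw [← hm, e, mul_comm]
        exact Nat.mul_le_mul_right _ h1
      · rw [← hm, e]
        exact Nat.mul_le_mul_right _ h0
    rw [one_mul]
    exact_mod_cast this)
  exact ⟨π, hπ, h.trans (ENNReal.ofReal_le_ofReal (by linarith [show (2 : ℝ) / m = 2 * (1 / m) by ring]))⟩

/-- A game in which the winning relation is as small as possible is a choice matching game. -/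
theorem nonempty_renaming_choiceMatching {m : ℕ} [NeZero m]
    (hc : ∀ i, Fintype.card (G.Choice i) = m) (hw : G.numWins = m) :
    Nonempty (Renaming (choiceMatching m) G) := by
  -- The degrees are at least 1 and average 1.
  have hdeg : ∀ i c, G.deg i c = 1 := by
    intro i c
    by_contra hne
    have : ∑ _c : G.Choice i, 1 < ∑ c, G.deg i c :=
      Finset.sum_lt_sum (fun c _ => deg_pos i c)
        ⟨c, Finset.mem_univ c, lt_of_le_of_ne (deg_pos i c) (Ne.symm hne)⟩
    rw [sum_deg, hw] at this
    simp [hc] at this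
  choose g hg hg0 using fun a => G.exists_win 0 a
  have ginj : Function.Injective fun a => g a 1 := fun a b e => by
    rw [← hg0 a, ← hg0 b, eq_of_deg_eq_one (hg a) (hg b) e (hdeg _ _)]
  have gbij : Function.Bijective fun a => g a 1 :=
    (Fintype.bijective_iff_injective_and_card _).2 ⟨ginj, by rw [hc, hc]⟩
  obtain ⟨ε⟩ : Nonempty (Fin m ≃ G.Choice 0) := ⟨(Fintype.equivFinOfCardEq (hc 0)).symm⟩
  refine ⟨⟨Equiv.refl _, fun i => match i with
    | 0 => ε
    | 1 => ε.trans (Equiv.ofBijective _ gbij), fun σ => ?_⟩⟩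
  constructor
  · intro e
    rw [choiceMatching_win] at e
    refine Set.mem_of_eq_of_mem (profile_ext (hg0 _).symm ?_) (hg (ε (σ 0)))
    exact congrArg (fun x : Fin m => g (ε x) 1) e.symm
  · intro h
    have := eq_of_deg_eq_one (i := 1) h (hg (ε (σ 1))) rfl (hdeg _ _)
    have := congrFun this 0
    rw [hg0] at this
    exact ε.injective this

end UpperBounds

/-! ### Counting degrees through the excess over one. -/

section Counting

/-- The total excess of f over 1 is r, and each value d contributes d - 1 to it. -/
theorem card_filter_eq_mul_le {ι : Type*} [Fintype ι] (f : ι → ℕ) (hf : ∀ c, 1 ≤ f c) {r : ℕ}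
    (hr : ∑ c, f c = Fintype.card ι + r) (d : ℕ) :
    (Finset.univ.filter fun c => f c = d).card * (d - 1) ≤ r := by
  have h1 : ∑ c, (f c - 1) + Fintype.card ι = ∑ c, f c := by
    rw [← Finset.card_univ, Finset.card_eq_sum_ones, ← Finset.sum_add_distrib]
    exact Finset.sum_congr rfl fun c _ => Nat.sub_add_cancel (hf c)
  have h2 : ∑ c ∈ Finset.univ.filter fun c => f c = d, (f c - 1) ≤ ∑ c, (f c - 1) :=
    Finset.sum_le_sum_of_subset (Finset.filter_subset _ _)
  rw [Finset.sum_congr rfl fun c hc => by rw [(Finset.mem_filter.1 hc).2], Finset.sum_const,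
    smul_eq_mul] at h2
  omega

/-- When only the values 1 and 2 occur, the excess r counts the twos. -/
theorem card_filter_eq_two {ι : Type*} [Fintype ι] (f : ι → ℕ) (hf : ∀ c, 1 ≤ f c)
    (hf2 : ∀ c, f c ≤ 2) {r : ℕ} (hr : ∑ c, f c = Fintype.card ι + r) :
    (Finset.univ.filter fun c => f c = 2).card = r ∧
      (Finset.univ.filter fun c => f c = 1).card + r = Fintype.card ι := by
  have h1 : ∑ c, f c = ∑ c, (1 + if f c = 2 then 1 else 0) := Finset.sum_congr rfl fun c _ => by
    have := hf c; have := hf2 c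
    split_ifs <;> omega
  rw [Finset.sum_add_distrib, ← Finset.card_eq_sum_ones, Finset.card_univ, Finset.sum_boole,
    Nat.cast_id, hr] at h1
  have h2 : (Finset.univ.filter fun c => f c = 1) = Finset.univ.filter fun c => ¬f c = 2 :=
    Finset.filter_congr fun c _ => by have := hf c; have := hf2 c; omega
  have h3 := Finset.card_filter_add_card_filter_not (s := (Finset.univ : Finset ι)) fun c => f c = 2
  rw [Finset.card_univ] at h3
  rw [h2]
  omega

theorem le_of_sum_eq_card_add {ι : Type*} [Fintype ι] (f : ι → ℕ) (hf : ∀ c, 1 ≤ f c) {r : ℕ}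
    (hr : ∑ c, f c = Fintype.card ι + r) (c : ι) : f c ≤ 1 + r := by
  have h1 : ∑ c, (f c - 1) + Fintype.card ι = ∑ c, f c := by
    rw [← Finset.card_univ, Finset.card_eq_sum_ones, ← Finset.sum_add_distrib]
    exact Finset.sum_congr rfl fun c _ => Nat.sub_add_cancel (hf c)
  have h2 := Finset.single_le_sum (f := fun c => f c - 1) (fun _ _ => Nat.zero_le _)
    (Finset.mem_univ c)
  omega

end Counting

/-! ### Size five: only the choice matching game reaches 7/3. -/

section SizeFive

variable {G : WLCGame 2}

theorem card_degFamily {s d : ℕ} {i : Fin 2} (hs : Fintype.card (G.Choice i) = s) :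
    (degFamily 2 s d G i).card = (Finset.univ.filter fun c => G.deg i c = d).card := by
  congr 1
  ext c
  simp [mem_degFamily, hs]

theorem degFamily_eq_empty {s d : ℕ} {i : Fin 2} (hs : Fintype.card (G.Choice i) ≠ s) :
    degFamily 2 s d G i = ∅ := by
  ext c
  simp [mem_degFamily, hs]

/-- A player with a distinguished number of choices, one of which has a distinguished degree. -/
theorem exists_ect_le_one_of_card_ne {i j : Fin 2} (hij : i ≠ j)
    (hc : Fintype.card (G.Choice i) ≠ Fintype.card (G.Choice j)) (d : ℕ)
    (hd : (Finset.univ.filter fun c => G.deg i c = d).card = 1) :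
    ∃ π : Protocol 2, π.IsStructural ∧ π.ect G ≤ ENNReal.ofReal 1 :=
  exists_ect_le_one (degFamily_isInvariant 2 _ d) hij ((card_degFamily rfl).trans hd)
    (degFamily_eq_empty hc.symm)

open Classical in
theorem card_image_core_le (d : ℕ) (i : Fin 2) : (coreFamily 2 d G i).card ≤
    (Finset.univ.filter fun σ : G.Profile => σ ∈ G.win ∧ ∀ j, G.deg j (σ j) = d).card := by
  refine le_trans (Finset.card_le_card ?_) (Finset.card_image_le (f := fun σ : G.Profile => σ i))
  intro c hc
  obtain ⟨σ, hσ, e, hd⟩ := mem_coreFamily.1 hc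
  exact Finset.mem_image.2 ⟨σ, by simp [hσ, hd], e⟩

theorem card_core_le_filter (d : ℕ) (i : Fin 2) :
    (coreFamily 2 d G i).card ≤ (Finset.univ.filter fun c => G.deg i c = d).card := by
  refine Finset.card_le_card fun c hc => ?_
  obtain ⟨σ, hσ, rfl, hd⟩ := mem_coreFamily.1 hc
  simp [hd]

open Classical in
theorem card_core_div_le_winSum {d : ℕ}
    (hne : ∃ σ ∈ G.win, ∀ j, G.deg j (σ j) = d) :
    ((Finset.univ.filter fun σ : G.Profile => σ ∈ G.win ∧ ∀ j, G.deg j (σ j) = d).card : ℝ) /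
      ((coreFamily 2 d G 0).card * (coreFamily 2 d G 1).card) ≤
      winSum G (unif (coreFamily 2 d G 0)) (unif (coreFamily 2 d G 1)) := by
  obtain ⟨σ, hσ, hd⟩ := hne
  have hn : ∀ i, (coreFamily 2 d G i).Nonempty := fun i => ⟨σ i, mem_coreFamily.2 ⟨σ, hσ, rfl, hd⟩⟩
  rw [winSum_unif (hn 0) (hn 1)]
  refine div_le_div_of_nonneg_right (Nat.cast_le.2 (Finset.card_le_card fun τ hτ => ?_))
    (by positivity)
  simp only [Finset.mem_filter, Finset.mem_univ, true_and] at hτ ⊢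
  exact ⟨hτ.1, mem_coreFamily.2 ⟨τ, hτ.1, rfl, hτ.2⟩, mem_coreFamily.2 ⟨τ, hτ.1, rfl, hτ.2⟩⟩

open Classical in
theorem card_wins_deg_eq (i : Fin 2) (d : ℕ) :
    (Finset.univ.filter fun σ : G.Profile => σ ∈ G.win ∧ G.deg i (σ i) = d).card =
      (Finset.univ.filter fun c => G.deg i c = d).card * d := by
  rw [Finset.card_eq_sum_card_fiberwise (f := fun σ => σ i)
    (t := Finset.univ.filter fun c => G.deg i c = d) (by intro σ; simp)]
  refine Finset.sum_const_nat fun c hc => ?_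
  rw [← (Finset.mem_filter.1 hc).2, deg, Finset.filter_filter]
  congr 1
  refine Finset.filter_congr fun σ _ => ?_
  constructor
  · rintro ⟨⟨h1, -⟩, h3⟩
    exact ⟨h1, h3⟩
  · rintro ⟨h1, rfl⟩
    exact ⟨⟨h1, rfl⟩, rfl⟩

-- There are 2r winning pairs at degree-two choices of the first player. At most s - r of them end
-- in a degree-one choice of the second player, so at least 3r - s stay in the core.
open Classical in
theorem le_card_core_two {r s : ℕ} (hs : ∀ i, Fintype.card (G.Choice i) = s)
    (hw : G.numWins = s + r) (hd : ∀ i c, G.deg i c ≤ 2) :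
    3 * r ≤ s + (Finset.univ.filter fun σ : G.Profile =>
      σ ∈ G.win ∧ ∀ j, G.deg j (σ j) = 2).card := by
  have h0 := card_filter_eq_two (G.deg 0) (deg_pos 0) (hd 0) (r := r) (by rw [sum_deg, hw, hs])
  have h1 := card_filter_eq_two (G.deg 1) (deg_pos 1) (hd 1) (r := r) (by rw [sum_deg, hw, hs])
  have e0 := card_wins_deg_eq (G := G) 0 2
  have e1 := card_wins_deg_eq (G := G) 1 1
  have hsub : (Finset.univ.filter fun σ : G.Profile => σ ∈ G.win ∧ G.deg 0 (σ 0) = 2) ⊆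
      (Finset.univ.filter fun σ : G.Profile => σ ∈ G.win ∧ ∀ j, G.deg j (σ j) = 2) ∪
      Finset.univ.filter fun σ : G.Profile => σ ∈ G.win ∧ G.deg 1 (σ 1) = 1 := by
    intro σ hσ
    simp only [Finset.mem_union, Finset.mem_filter, Finset.mem_univ, true_and, Fin.forall_fin_two]
      at hσ ⊢
    have a := hd 1 (σ 1)
    have b := deg_pos 1 (σ 1)
    by_cases h : G.deg 1 (σ 1) = 1
    · exact Or.inr ⟨hσ.1, h⟩
    · exact Or.inl ⟨hσ.1, hσ.2, by omega⟩
  have := (Finset.card_le_card hsub).trans (Finset.card_union_le _ _)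
  rw [hs] at h0 h1
  omega

/-- In all games of size five but the choice matching game, the expected coordination time can be
made smaller than `7 / 3`. -/
theorem exists_ect_lt_of_mem_choiceGames_five (hG : G ∈ choiceGames 5)
    (hne : ¬Nonempty (Renaming (choiceMatching 5) G)) :
    ∃ π : Protocol 2, π.IsStructural ∧ π.ect G < ENNReal.ofReal (2 + 1 / 3) := by
  classical
  have hθ : (0 : ℝ) < 2 + 1 / 3 := by norm_num
  have h2θ : (2 : ℝ) < 2 + 1 / 3 := by norm_num
  have h1θ : (1 : ℝ) < 2 + 1 / 3 := by norm_num
  have hm : max (Fintype.card (G.Choice 0)) (Fintype.card (G.Choice 1)) = 5 := hG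
  obtain ⟨i, j, hij, hi, hj⟩ : ∃ i j : Fin 2, i ≠ j ∧ Fintype.card (G.Choice i) = 5 ∧
      Fintype.card (G.Choice j) ≤ 5 := by
    rcases max_choice (Fintype.card (G.Choice 0)) (Fintype.card (G.Choice 1)) with e | e
    · exact ⟨0, 1, zero_ne_one, by omega, by omega⟩
    · exact ⟨1, 0, one_ne_zero, by omega, by omega⟩
  have pj : 0 < Fintype.card (G.Choice j) := Fintype.card_pos
  have hcard : Fintype.card (G.Choice 0) * Fintype.card (G.Choice 1) =
      5 * Fintype.card (G.Choice j) := by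
    have : (i = 0 ∧ j = 1) ∨ (i = 1 ∧ j = 0) := by omega
    rcases this with ⟨rfl, rfl⟩ | ⟨rfl, rfl⟩
    · rw [hi]
    · rw [hi, mul_comm]
  have hw := card_choice_le_numWins G i
  -- A first round with winning probability p gives 3 - 2p, which is below 7/3 exactly when p > 1/3.
  by_cases hunif : 5 * Fintype.card (G.Choice j) < 3 * G.numWins
  · refine exists_ect_lt_of_family univ_isInvariant hθ ?_
    rw [winSum_unif_univ, ← Nat.cast_mul, hcard]
    have : (1 : ℝ) / 3 < G.numWins / ((5 * Fintype.card (G.Choice j) : ℕ) : ℝ) := by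
      rw [div_lt_div_iff₀ (by norm_num) (by positivity)]
      have : ((5 * Fintype.card (G.Choice j) : ℕ) : ℝ) < ((3 * G.numWins : ℕ) : ℝ) :=
        Nat.cast_lt.2 hunif
      push_cast at this ⊢
      linarith
    linarith
  rcases hj.lt_or_eq with hj | hj
  · refine exists_ect_lt_of_le hθ h1θ ?_
    have hcne : Fintype.card (G.Choice j) ≠ Fintype.card (G.Choice i) := by omega
    have si := sum_deg G i
    have sj := sum_deg G j
    -- In each sparse case some player has a degree value attained exactly once, and unequal choice
    -- counts make that player identifiable.
    have cases : (Fintype.card (G.Choice j) = 4 ∧ G.numWins = 5) ∨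
      (Fintype.card (G.Choice j) = 4 ∧ G.numWins = 6) ∨
      (Fintype.card (G.Choice j) = 3 ∧ G.numWins = 5) := by omega
    rcases cases with ⟨hs, he⟩ | ⟨hs, he⟩ | ⟨hs, he⟩
    · have hr : ∑ c, G.deg j c = Fintype.card (G.Choice j) + 1 := by omega
      exact exists_ect_le_one_of_card_ne hij.symm hcne 2
        (card_filter_eq_two _ (deg_pos j) (le_of_sum_eq_card_add _ (deg_pos j) hr) hr).1
    · have hr : ∑ c, G.deg i c = Fintype.card (G.Choice i) + 1 := by omega
      exact exists_ect_le_one_of_card_ne hij hcne.symm 2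
        (card_filter_eq_two _ (deg_pos i) (le_of_sum_eq_card_add _ (deg_pos i) hr) hr).1
    · have hr : ∑ c, G.deg j c = Fintype.card (G.Choice j) + 2 := by omega
      have hle := le_of_sum_eq_card_add _ (deg_pos j) hr
      -- Three degrees with sum 5: either 3, 1, 1 or 2, 2, 1.
      by_cases h3 : ∃ c, G.deg j c = 3
      · obtain ⟨c, hc⟩ := h3
        refine exists_ect_le_one_of_card_ne hij.symm hcne 3 ?_
        have h1 := card_filter_eq_mul_le _ (deg_pos j) hr 3
        have h2 : 0 < (Finset.univ.filter fun c => G.deg j c = 3).card :=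
          Finset.card_pos.2 ⟨c, by simp [hc]⟩
        omega
      · push Not at h3
        refine exists_ect_le_one_of_card_ne hij.symm hcne 1 ?_
        have := (card_filter_eq_two _ (deg_pos j) (fun c => by
          have := hle c; have := h3 c; omega) hr).2
        omega
  · have hall : ∀ k, Fintype.card (G.Choice k) = 5 := by
      intro k
      have : k = i ∨ k = j := by omega
      rcases this with rfl | rfl <;> assumption
    obtain ⟨r, hr⟩ : ∃ r, G.numWins = 5 + r := ⟨G.numWins - 5, by omega⟩
    have hr0 : r ≠ 0 := fun h0 => hne (nonempty_renaming_choiceMatching hall (by omega))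
    have hsum : ∀ k, ∑ c, G.deg k c = Fintype.card (G.Choice k) + r := fun k => by
      rw [sum_deg, hr, hall]
    -- Here r ≤ 3, so a degree of at least 3 occurs at most once for each player.
    by_cases h3 : ∃ k c, 3 ≤ G.deg k c
    · obtain ⟨k, c, hc⟩ := h3
      refine exists_ect_lt_of_le hθ h2θ (exists_ect_le_two
        (degFamily_isInvariant 2 5 (G.deg k c)) (fun l => ?_) ⟨k, c, mem_degFamily.2 ⟨hall k, rfl⟩⟩)
      rw [card_degFamily (hall l)]
      have h1 := card_filter_eq_mul_le _ (deg_pos l) (hsum l) (G.deg k c)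
      by_contra h2
      have := Nat.mul_le_mul (not_le.1 h2) (show 2 ≤ G.deg k c - 1 by omega)
      omega
    · push Not at h3
      have hd : ∀ k c, G.deg k c ≤ 2 := fun k c => Nat.lt_succ_iff.1 (h3 k c)
      have htwo := fun k => (card_filter_eq_two _ (deg_pos k) (hd k) (hsum k)).1
      by_cases hr1 : r = 1
      · subst hr1
        refine exists_ect_lt_of_le hθ h2θ (exists_ect_le_two
          (degFamily_isInvariant 2 5 2) (fun l => ?_) ⟨0, ?_⟩)
        · rw [card_degFamily (hall l), htwo]
        · rw [← Finset.card_pos, card_degFamily (hall 0), htwo]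
          exact one_pos
      · have hcore := le_card_core_two hall hr hd
        set f := (Finset.univ.filter fun σ : G.Profile =>
          σ ∈ G.win ∧ ∀ j, G.deg j (σ j) = 2).card with hf
        have hfpos : 0 < f := by omega
        obtain ⟨σ, hσ⟩ := Finset.card_pos.1 hfpos
        simp only [Finset.mem_filter, Finset.mem_univ, true_and] at hσ
        have hle := card_core_div_le_winSum ⟨σ, hσ⟩
        refine exists_ect_lt_of_family (coreFamily_isInvariant 2 2) hθ ?_
        have a0 := card_core_le_filter (G := G) 2 0
        have a1 := card_core_le_filter (G := G) 2 1
        have b0 := card_image_core_le (G := G) 2 0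
        have p0 : 0 < (coreFamily 2 2 G 0).card :=
          Finset.card_pos.2 ⟨σ 0, mem_coreFamily.2 ⟨σ, hσ.1, rfl, hσ.2⟩⟩
        have p1 : 0 < (coreFamily 2 2 G 1).card :=
          Finset.card_pos.2 ⟨σ 1, mem_coreFamily.2 ⟨σ, hσ.1, rfl, hσ.2⟩⟩
        rw [htwo] at a0 a1
        rw [← hf] at b0 hle
        -- The core has f ≥ 3r - 5 winning pairs. For r = 2 the product is at most f · 2; for r = 3
        -- it is at most 9, while f ≥ 4.
        have hlt : (coreFamily 2 2 G 0).card * (coreFamily 2 2 G 1).card < 3 * f := by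
          rcases (by omega : r = 2 ∨ r = 3) with rfl | rfl
          · have := Nat.mul_le_mul b0 a1
            omega
          · have := Nat.mul_le_mul a0 a1
            omega
        have : (1 : ℝ) / 3 < f / ((coreFamily 2 2 G 0).card * (coreFamily 2 2 G 1).card) := by
          rw [div_lt_div_iff₀ (by norm_num) (by positivity)]
          have : (((coreFamily 2 2 G 0).card * (coreFamily 2 2 G 1).card : ℕ) : ℝ) <
            ((3 * f : ℕ) : ℝ) := Nat.cast_lt.2 hlt
          push_cast at this ⊢
          linarith
        linarith

end SizeFive

/-- In the game `G`, each player has a hub, her choice in `κ`, and exactly the profiles in which one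
player chooses the hub and the other one does not are winning. -/
def IsCross (G : WLCGame 2) (κ : G.Profile) : Prop :=
  ∀ σ : G.Profile, σ ∈ G.win ↔ (σ 0 = κ 0 ↔ ¬σ 1 = κ 1)

theorem exists_equiv_apply_eq {α β : Type*} [Fintype α] [Fintype β]
    (h : Fintype.card α = Fintype.card β) {a a' : α} {b b' : β} (ha : a ≠ a') (hb : b ≠ b') :
    ∃ e : α ≃ β, e a = b ∧ e a' = b' := by
  classical
  let e := (Fintype.equivOfCardEq h)
  let e1 := e.trans (Equiv.swap (e a) b)
  have h1 : e1 a = b := by simp [e1]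
  refine ⟨e1.trans (Equiv.swap (e1 a') b'), ?_, by simp⟩
  rw [Equiv.trans_apply, h1, Equiv.swap_apply_of_ne_of_ne _ hb]
  rw [← h1]
  exact fun h => ha (e1.injective h)

/-! ### Cross games and their symmetries. -/

section Renamings

variable {G G' : WLCGame 2} {κ : G.Profile} {κ' : G'.Profile}

theorem IsCross.nonempty_renaming (hG : IsCross G κ) (hG' : IsCross G' κ')
    (e0 : G.Choice 0 ≃ G'.Choice 0) (e1 : G.Choice 1 ≃ G'.Choice 1) (h0 : e0 (κ 0) = κ' 0)
    (h1 : e1 (κ 1) = κ' 1) : Nonempty (Renaming G G') := by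
  refine ⟨⟨Equiv.refl _, fun i => match i with
    | 0 => e0
    | 1 => e1, fun σ => ?_⟩⟩
  rw [hG, hG']
  change _ ↔ (e0 (σ 0) = κ' 0 ↔ ¬e1 (σ 1) = κ' 1)
  rw [← h0, ← h1, e0.apply_eq_iff_eq, e1.apply_eq_iff_eq]

/-- The renaming of a cross game that exchanges the players. -/
def IsCross.swapRenaming (hG : IsCross G κ) (ρ : G.Choice 0 ≃ G.Choice 1) (hρ : ρ (κ 0) = κ 1) :
    Renaming G G where
  perm := Equiv.swap 0 1
  equiv := fun i => match i with
    | 0 => ρ.symm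
    | 1 => ρ
  win_iff := fun σ => by
    rw [hG, hG]
    change _ ↔ (ρ.symm (σ 1) = κ 0 ↔ ¬ρ (σ 0) = κ 1)
    rw [Equiv.symm_apply_eq, hρ, ← hρ, ρ.apply_eq_iff_eq]
    tauto

/-- A bijection ρ that matches the hubs and every past round turns the exchange of players into a
symmetry of the stage. -/
theorem IsCross.structural_apply {π : Protocol 2} (hπ : π.IsStructural) (hG : IsCross G κ)
    {ρ : G.Choice 0 ≃ G.Choice 1} (hρ : ρ (κ 0) = κ 1) {h : G.History}
    (hh : ∀ σ ∈ h, σ 1 = ρ (σ 0)) (c : G.Choice 0) : π 0 G h c = π 1 G h (ρ c) := by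
  refine hπ G G h h (hG.swapRenaming ρ hρ) ?_ 1 c
  refine (List.map_id h).symm.trans (List.map_congr_left fun σ hσ => ?_)
  refine profile_ext ?_ (hh σ hσ)
  change σ 0 = ρ.symm (σ 1)
  rw [hh σ hσ, ρ.symm_apply_apply]

end Renamings

/-! ### Cross games of size three: the lower bound. -/

section LowerBound

variable {G : WLCGame 2} {κ : G.Profile}

theorem exists_equiv_fin_three {α : Type*} [Fintype α] (h : Fintype.card α = 3) {a a' : α}
    (ha : a ≠ a') : ∃ e : Fin 3 ≃ α, e 0 = a ∧ e 1 = a' :=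
  exists_equiv_apply_eq (by simp [h]) (by decide) ha

/-- Identifying the players through ρ, both use the same weights: p on the hub and s, t on the two
leaves. Failures are hub against hub, corresponding leaves (s² + t²) and different leaves (2st). -/
theorem IsCross.one_step_le {π : Protocol 2} (hπ : π.IsStructural) (hG : IsCross G κ)
    (hc : Fintype.card (G.Choice 0) = 3) {ρ : G.Choice 0 ≃ G.Choice 1} (hρ : ρ (κ 0) = κ 1)
    {h : G.History} (hh : ∀ σ ∈ h, σ 1 = ρ (σ 0)) {F : G.History → ℝ} {u v w : ℝ}
    (hu : u ≤ F (h ++ [κ])) (hv : ∀ x, x ≠ κ 0 → v ≤ F (h ++ [pair x (ρ x)]))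
    (hw : ∀ x y, x ≠ κ 0 → y ≠ κ 1 → w ≤ F (h ++ [pair x y])) :
    ∃ p s t : ℝ, 0 ≤ s ∧ 0 ≤ t ∧ p + s + t = 1 ∧
      u * p ^ 2 + v * (s ^ 2 + t ^ 2) + w * (2 * s * t) ≤
        ∑ σ, open Classical in if σ ∈ G.win then 0 else π.prob G h σ * F (h ++ [σ]) := by
  classical
  obtain ⟨x, hx⟩ : ∃ x, κ 0 ≠ x := by
    have : Nontrivial (G.Choice 0) := Fintype.one_lt_card_iff_nontrivial.1 (by omega)
    obtain ⟨x, hx⟩ := exists_ne (κ 0)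
    exact ⟨x, hx.symm⟩
  obtain ⟨e, e0, -⟩ := exists_equiv_fin_three hc hx
  set μ : Fin 3 → ℝ := fun c => (π 0 G h (e c)).toReal with hμ
  have μ0 : ∀ c, 0 ≤ μ c := fun c => ENNReal.toReal_nonneg
  have hsum : ∑ c, μ c = 1 := by
    rw [← sum_toReal_pmf (π 0 G h), ← Equiv.sum_comp e]
  rw [Fin.sum_univ_three] at hsum
  refine ⟨μ 0, μ 1, μ 2, μ0 1, μ0 2, hsum, ?_⟩
  have hprob : ∀ a b, π.prob G h (pair (e a) (ρ (e b))) = μ a * μ b := by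
    intro a b
    rw [Protocol.prob, Fin.prod_univ_two, pair_zero, pair_one,
      ← IsCross.structural_apply hπ hG hρ hh]
  have hne : ∀ a : Fin 3, a ≠ 0 → e a ≠ κ 0 := fun a ha h => ha (e.injective (h.trans e0.symm))
  have hne' : ∀ a : Fin 3, a ≠ 0 → ρ (e a) ≠ κ 1 := fun a ha h =>
    hne a ha (ρ.injective (h.trans hρ.symm))
  have key : ∀ a b : Fin 3, (if a = 0 then if b = 0 then u else 0 else if b = 0 then 0 else
      if a = b then v else w) * (μ a * μ b) ≤
      if pair (e a) (ρ (e b)) ∈ G.win then 0 else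
        π.prob G h (pair (e a) (ρ (e b))) * F (h ++ [pair (e a) (ρ (e b))]) := by
    intro a b
    have hnn := mul_nonneg (μ0 a) (μ0 b)
    rw [hprob, hG, pair_zero, pair_one]
    by_cases ha : a = 0 <;> by_cases hb : b = 0
    · subst ha; subst hb
      have : pair (e 0) (ρ (e 0)) = κ := profile_ext e0 (by simp [e0, hρ])
      rw [this]
      simp only [if_true, e0, hρ, not_true, iff_false, if_false]
      rw [mul_comm]
      exact mul_le_mul_of_nonneg_left hu hnn
    · subst ha
      simp [hb, e0, hne' b hb]
    · subst hb
      simp [ha, e0, hne a ha, hρ]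
    · simp only [if_neg ha, if_neg hb, hne a ha, hne' b hb, not_false_iff, iff_true, if_false]
      rw [mul_comm]
      refine mul_le_mul_of_nonneg_left ?_ hnn
      split_ifs with hab
      · subst hab
        exact hv _ (hne a ha)
      · exact hw _ _ (hne a ha) (hne' b hb)
  rw [sum_profile, ← Equiv.sum_comp e]
  have e1 : ∀ f : G.Choice 1 → ℝ, ∑ b, f b = ∑ b, f (ρ (e b)) := fun f => by
    rw [← Equiv.sum_comp ρ, ← Equiv.sum_comp e]
  have total := Finset.sum_le_sum fun a (_ : a ∈ Finset.univ) =>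
    Finset.sum_le_sum fun b (_ : b ∈ Finset.univ) => key a b
  refine le_trans (le_of_eq ?_) (total.trans (le_of_eq ?_))
  · simp [Fin.sum_univ_three]
    ring
  · exact Finset.sum_congr rfl fun a _ => by rw [e1]

open Classical in
/-- A lower bound of the expected coordination time in the stages of a cross game. -/
def crossBound (κ : G.Profile) (α β : ℝ) (h : G.History) : ℝ :=
  if ∀ σ ∈ h, σ = κ then α
  else if ∃ ρ : G.Choice 0 ≃ G.Choice 1, ρ (κ 0) = κ 1 ∧ ∀ σ ∈ h, σ 1 = ρ (σ 0) then β else 1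

/-- While only hubs were played, the leaves of the two players are not yet identified, so any first
pair of leaves can be matched by some ρ. Only a later pair of non-corresponding leaves may break the
symmetry. -/
theorem IsCross.le_ect {π : Protocol 2} (hπ : π.IsStructural) (hG : IsCross G κ)
    (h0 : Fintype.card (G.Choice 0) = 3) (h1 : Fintype.card (G.Choice 1) = 3) {α β : ℝ}
    (hβ : 1 ≤ β) (hαβ : β ≤ α) (hα : α ^ 2 - α = β) (hβ2 : 2 * β ^ 2 = 3 * β + 1) :
    ENNReal.ofReal α ≤ π.ect G := by
  classical
  have hb1 : ∀ h : G.History, 1 ≤ crossBound κ α β h := fun h => by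
    unfold crossBound; split_ifs <;> linarith
  have hbβ : ∀ h : G.History, (∃ ρ : G.Choice 0 ≃ G.Choice 1, ρ (κ 0) = κ 1 ∧
      ∀ σ ∈ h, σ 1 = ρ (σ 0)) → β ≤ crossBound κ α β h := fun h hh => by
    rw [crossBound, if_pos hh]; split_ifs <;> linarith
  have := π.le_ectFrom (crossBound κ α β) α
    (fun h => by unfold crossBound; split_ifs <;> linarith) (fun h => ?_) []
  · rwa [crossBound, if_pos (by simp)] at this
  by_cases hA : ∀ σ ∈ h, σ = κ
  · rw [crossBound, if_pos hA]
    obtain ⟨ρ, hρ⟩ : ∃ ρ : G.Choice 0 ≃ G.Choice 1, ρ (κ 0) = κ 1 := by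
      obtain ⟨e⟩ := Fintype.card_eq.1 (h0.trans h1.symm)
      exact ⟨e.trans (Equiv.swap (e (κ 0)) (κ 1)), by simp⟩
    have hβ' : ∀ x y, x ≠ κ 0 → y ≠ κ 1 → β ≤ crossBound κ α β (h ++ [pair x y]) := by
      intro x y hx hy
      obtain ⟨ρ, hρ0, hρ1⟩ := exists_equiv_apply_eq (h0.trans h1.symm) hx.symm hy.symm
      refine hbβ _ ⟨ρ, hρ0, fun σ hσ => ?_⟩
      rcases List.mem_append.1 hσ with hσ | hσ
      · rw [hA σ hσ, hρ0]
      · rw [List.mem_singleton.1 hσ, pair_one, pair_zero, hρ1]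
    obtain ⟨p, s, t, hs, ht, hsum, hle⟩ := hG.one_step_le hπ h0 hρ (h := h)
      (fun σ hσ => by rw [hA σ hσ, hρ]) (F := crossBound κ α β) (u := α) (v := β) (w := β)
      (by
        rw [crossBound, if_pos]
        intro σ hσ
        rcases List.mem_append.1 hσ with hσ | hσ
        · exact hA σ hσ
        · exact List.mem_singleton.1 hσ)
      (fun x hx => hβ' x _ hx fun h => hx (ρ.injective (h.trans hρ.symm))) hβ'
    refine le_trans ?_ (add_le_add_right hle 1)
    have hp : p = 1 - (s + t) := by linarith
    subst hp hα
    -- Since β = α² - α, the one-step expectation is α + (1 - (s + t)α)².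
    nlinarith [sq_nonneg (1 - (s + t) * α)]
  · by_cases hB : ∃ ρ : G.Choice 0 ≃ G.Choice 1, ρ (κ 0) = κ 1 ∧ ∀ σ ∈ h, σ 1 = ρ (σ 0)
    · rw [crossBound, if_neg hA, if_pos hB]
      obtain ⟨ρ, hρ, hh⟩ := hB
      obtain ⟨p, s, t, hs, ht, hsum, hle⟩ := hG.one_step_le hπ h0 hρ hh (F := crossBound κ α β)
        (u := β) (v := β) (w := 1)
        (hbβ _ ⟨ρ, hρ, fun σ hσ => by
          rcases List.mem_append.1 hσ with hσ | hσ
          · exact hh σ hσ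
          · rw [List.mem_singleton.1 hσ, hρ]⟩)
        (fun x hx => hbβ _ ⟨ρ, hρ, fun σ hσ => by
          rcases List.mem_append.1 hσ with hσ | hσ
          · exact hh σ hσ
          · rw [List.mem_singleton.1 hσ, pair_one, pair_zero]⟩)
        fun x y _ _ => hb1 _
      refine le_trans ?_ (add_le_add_right hle 1)
      have hp : p = 1 - (s + t) := by linarith
      subst hp
      -- Since 2β² = 3β + 1, the one-step expectation is β + (1 - (s + t)β)² + (β - 1)(s - t)²/2.
      have h1 := sq_nonneg (1 - (s + t) * β)
      have h2 := mul_nonneg (sub_nonneg.2 hβ) (sq_nonneg (s - t))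
      have h3 : (s + t) ^ 2 * (2 * β ^ 2) = (s + t) ^ 2 * (3 * β + 1) := by rw [hβ2]
      nlinarith
    · rw [crossBound, if_neg hA, if_neg hB]
      refine le_add_of_nonneg_right (Finset.sum_nonneg fun σ _ => ?_)
      split_ifs
      · exact le_rfl
      · exact mul_nonneg (π.prob_nonneg h σ) (zero_le_one.trans (hb1 _))

end LowerBound

/-! ### The hub-or-leaf protocol. -/

section CrossProtocol

variable {n : ℕ} {G G' : WLCGame n}

/-- All choices of the profile have degree one. -/
def IsLeafProfile (G : WLCGame n) (σ : G.Profile) : Prop := ∀ i, G.deg i (σ i) = 1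

/-- The choices of degree one. -/
def leafFamily (n : ℕ) : Family n := fun G i => Finset.univ.filter fun c => G.deg i c = 1

/-- The choices of degree other than one. -/
def hubFamily (n : ℕ) : Family n := fun G i => Finset.univ.filter fun c => G.deg i c ≠ 1

open Classical in
/-- The first leaf profile in the history. -/
def firstLeaf (h : G.History) : Option G.Profile := h.find? fun σ => decide (G.IsLeafProfile σ)

open Classical in
/-- The first leaf profile in the history that shares some but not all choices with `σ`. -/
def firstBreak (σ : G.Profile) (h : G.History) : Option G.Profile :=
  h.find? fun τ => decide (G.IsLeafProfile τ ∧ (∃ i, τ i = σ i) ∧ ∃ i, τ i ≠ σ i)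

open Classical in
/-- The probability with which player `i` chooses a leaf: `p` if there is no leaf profile in the
history, `q` if the leaf profiles do not distinguish the players, and otherwise it depends on
whether player `i` is the one who repeated her choice. -/
def leafProb (p q : ℝ) (i : Fin n) (G : WLCGame n) (h : G.History) : ℝ :=
  match firstLeaf h with
  | none => p
  | some σ => match firstBreak σ h with
    | none => q
    | some τ => if τ i = σ i then 0 else 1

theorem Renaming.isLeafProfile_iff (r : Renaming G G') (σ : G.Profile) :
    G'.IsLeafProfile (r.mapProfile σ) ↔ G.IsLeafProfile σ := by
  simp only [IsLeafProfile, r.mapProfile_apply, r.deg_eq]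
  exact (r.perm.surjective.forall (p := fun j => G.deg j (σ j) = 1)).symm

theorem Renaming.firstLeaf_map (r : Renaming G G') (h : G.History) :
    firstLeaf (h.map r.mapProfile) = (firstLeaf h).map r.mapProfile := by
  rw [firstLeaf, firstLeaf, List.find?_map]
  exact congrArg (fun P => (h.find? P).map r.mapProfile)
    (funext fun σ => decide_eq_decide.2 (r.isLeafProfile_iff σ))

theorem Renaming.firstBreak_map (r : Renaming G G') (σ : G.Profile) (h : G.History) :
    firstBreak (r.mapProfile σ) (h.map r.mapProfile) = (firstBreak σ h).map r.mapProfile := by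
  rw [firstBreak, firstBreak, List.find?_map]
  refine congrArg (fun P => (h.find? P).map r.mapProfile)
    (funext fun τ => decide_eq_decide.2 ((r.isLeafProfile_iff τ).and (and_congr ?_ ?_)))
  · simp only [r.mapProfile_apply, (r.equiv _).apply_eq_iff_eq]
    exact (r.perm.surjective.exists (p := fun j => τ j = σ j)).symm
  · simp only [r.mapProfile_apply, ne_eq, (r.equiv _).apply_eq_iff_eq]
    exact (r.perm.surjective.exists (p := fun j => ¬τ j = σ j)).symm

theorem Renaming.leafProb_eq (r : Renaming G G') (p q : ℝ) (i : Fin n) (h : G.History) :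
    leafProb p q i G' (h.map r.mapProfile) = leafProb p q (r.perm i) G h := by
  unfold leafProb
  rw [r.firstLeaf_map]
  rcases firstLeaf h with _ | σ
  · rfl
  · simp only [Option.map_some, r.firstBreak_map]
    rcases firstBreak σ h with _ | τ
    · rfl
    · by_cases e : τ (r.perm i) = σ (r.perm i) <;> simp [r.mapProfile_apply, e]

theorem leafProb_mem {p q : ℝ} (hp : p ∈ Set.Icc (0 : ℝ) 1) (hq : q ∈ Set.Icc (0 : ℝ) 1) (i : Fin n)
    (h : G.History) : leafProb p q i G h ∈ Set.Icc (0 : ℝ) 1 := by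
  unfold leafProb
  split
  · exact hp
  · split
    · exact hq
    · split_ifs <;> simp

/-- Each player chooses a leaf with the probability `leafProb`, and otherwise a hub. -/
def crossProtocol (n : ℕ) {p q : ℝ} (hp : p ∈ Set.Icc (0 : ℝ) 1) (hq : q ∈ Set.Icc (0 : ℝ) 1) :
    Protocol n :=
  Protocol.ofWeights (fun i G h c => leafProb p q i G h * unif (leafFamily n G i) c +
      (1 - leafProb p q i G h) * unif (hubFamily n G i) c)
    (fun i G h c => add_nonneg (mul_nonneg (leafProb_mem hp hq i h).1 (unif_nonneg _ _))
      (mul_nonneg (sub_nonneg.2 (leafProb_mem hp hq i h).2) (unif_nonneg _ _)))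
    (fun i G h => by
      rw [Finset.sum_add_distrib, ← Finset.mul_sum, ← Finset.mul_sum, sum_unif, sum_unif]
      ring)

theorem crossProtocol_isStructural {p q : ℝ} (hp : p ∈ Set.Icc (0 : ℝ) 1)
    (hq : q ∈ Set.Icc (0 : ℝ) 1) : (crossProtocol n hp hq).IsStructural := by
  refine Protocol.ofWeights_isStructural fun G G' r h i c => ?_
  rw [r.leafProb_eq, unif_equiv (r.equiv i) (T := leafFamily n G' i),
    unif_equiv (r.equiv i) (T := hubFamily n G' i)]
  · intro c; simp [hubFamily, r.deg_eq]
  · intro c; simp [leafFamily, r.deg_eq]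

theorem firstLeaf_append (h : G.History) (σ : G.Profile) [Decidable (G.IsLeafProfile σ)] :
    firstLeaf (h ++ [σ]) = (firstLeaf h).or (if G.IsLeafProfile σ then some σ else none) := by
  rw [firstLeaf, List.find?_append, List.find?_singleton]
  simp only [decide_eq_true_eq]
  congr

theorem firstBreak_append (σ : G.Profile) (h : G.History) (τ : G.Profile)
    [Decidable (G.IsLeafProfile τ ∧ (∃ i, τ i = σ i) ∧ ∃ i, τ i ≠ σ i)] :
    firstBreak σ (h ++ [τ]) = (firstBreak σ h).or
      (if G.IsLeafProfile τ ∧ (∃ i, τ i = σ i) ∧ ∃ i, τ i ≠ σ i then some τ else none) := by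
  rw [firstBreak, List.find?_append, List.find?_singleton]
  simp only [decide_eq_true_eq]
  congr

theorem firstBreak_eq_none_of_firstLeaf {h : G.History} (hh : firstLeaf h = none) (σ : G.Profile) :
    firstBreak σ h = none := by
  rw [firstLeaf, List.find?_eq_none] at hh
  rw [firstBreak, List.find?_eq_none]
  intro τ hτ
  have := hh τ hτ
  simp only [decide_eq_true_eq] at this ⊢
  exact fun h => this h.1

end CrossProtocol

/-! ### Optimality of the hub-or-leaf protocol in cross games of size three. -/

section CrossUpperBound

variable {G : WLCGame 2} {κ : G.Profile}

/-- A leaf wins only against the opposing hub, whereas a hub wins against both opposing leaves. Thus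
degrees reveal the hubs to a structural protocol. -/
theorem IsCross.deg_eq_one_iff (hG : IsCross G κ) (hc : ∀ i, Fintype.card (G.Choice i) = 3)
    (i : Fin 2) (c : G.Choice i) : G.deg i c = 1 ↔ c ≠ κ i := by
  classical
  constructor
  · rintro h rfl
    obtain ⟨j, hj⟩ : ∃ j : Fin 2, j ≠ i := exists_ne i
    have h2 : 2 < Fintype.card (G.Choice j) := by rw [hc]; norm_num
    obtain ⟨x, y, z, hxy, hxz, hyz⟩ := Fintype.two_lt_card_iff.1 h2
    obtain ⟨x, y, hx, hy, hxy⟩ : ∃ x y, x ≠ κ j ∧ y ≠ κ j ∧ x ≠ y := by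
      by_cases h1 : x = κ j
      · exact ⟨y, z, h1 ▸ hxy.symm, h1 ▸ hxz.symm, hyz⟩
      · by_cases h2 : y = κ j
        · exact ⟨x, z, h1, h2 ▸ hyz.symm, hxz⟩
        · exact ⟨x, y, h1, h2, hxy⟩
    have hwin : ∀ x, x ≠ κ j → Function.update κ j x ∈ G.win := by
      intro x hx
      rw [hG]
      have : (i = 0 ∧ j = 1) ∨ (i = 1 ∧ j = 0) := by omega
      rcases this with ⟨rfl, rfl⟩ | ⟨rfl, rfl⟩ <;> simp [hx]
    have := eq_of_deg_eq_one (i := i) (hwin x hx) (hwin y hy) (by simp [hj.symm])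
      (by simpa [hj.symm] using h)
    exact hxy (by simpa using congrFun this j)
  · intro h
    refine le_antisymm (Finset.card_le_one.2 ?_) (deg_pos i c)
    simp only [Finset.mem_filter, Finset.mem_univ, true_and]
    rintro σ ⟨hσ, e⟩ τ ⟨hτ, e'⟩
    rw [hG] at hσ hτ
    have : i = 0 ∨ i = 1 := by omega
    rcases this with rfl | rfl
    · exact profile_ext (e.trans e'.symm)
        ((not_not.1 (mt hσ.2 (e ▸ h))).trans (not_not.1 (mt hτ.2 (e' ▸ h))).symm)
    · exact profile_ext ((hσ.2 (e ▸ h)).trans (hτ.2 (e' ▸ h)).symm) (e.trans e'.symm)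

/-- The value of the protocol `crossProtocol` in a stage of a cross game. -/
def crossValue (α β : ℝ) (h : G.History) : ℝ :=
  match firstLeaf h with
  | none => α
  | some σ => match firstBreak σ h with
    | none => β
    | some _ => 1

open Classical in
theorem IsCross.sum_fail_eq (hG : IsCross G κ) (e0 : Fin 3 ≃ G.Choice 0) (e1 : Fin 3 ≃ G.Choice 1)
    (h0 : e0 0 = κ 0) (h1 : e1 0 = κ 1) (f : G.Profile → ℝ) :
    ∑ σ, (if σ ∈ G.win then 0 else f σ) = f κ + (f (pair (e0 1) (e1 1)) +
      f (pair (e0 1) (e1 2)) + f (pair (e0 2) (e1 1)) + f (pair (e0 2) (e1 2))) := by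
  classical
  have hκ : pair (e0 0) (e1 0) = κ := profile_ext h0 h1
  have hw : ∀ a b, pair (e0 a) (e1 b) ∈ G.win ↔ (a = 0 ↔ ¬b = 0) := fun a b => by
    rw [hG, pair_zero, pair_one, ← h0, ← h1, e0.apply_eq_iff_eq, e1.apply_eq_iff_eq]
  rw [sum_profile, ← Equiv.sum_comp e0]
  simp only [← Equiv.sum_comp e1, Fin.sum_univ_three, hw, hκ]
  simp
  ring

/-- The probabilities 1/α and 1/β are where the squares in the lower bound vanish. After a break
exactly one player has repeated the leaf of the first leaf pair; that player takes the hub, the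
other a leaf, and they win at once. -/
theorem IsCross.crossProtocol_ect_le (hG : IsCross G κ)
    (hc : ∀ i, Fintype.card (G.Choice i) = 3) {α β : ℝ}
    (hβ : 1 ≤ β) (hα1 : 1 ≤ α) (hα : α ^ 2 - α = β) (hβ2 : 2 * β ^ 2 = 3 * β + 1)
    (hp : 1 / α ∈ Set.Icc (0 : ℝ) 1) (hq : 1 / β ∈ Set.Icc (0 : ℝ) 1) :
    (crossProtocol 2 hp hq).ect G ≤ ENNReal.ofReal α := by
  classical
  set π := crossProtocol 2 hp hq with hπ
  have hleaf : ∀ σ : G.Profile, G.IsLeafProfile σ ↔ σ 0 ≠ κ 0 ∧ σ 1 ≠ κ 1 := by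
    intro σ
    simp only [IsLeafProfile, Fin.forall_fin_two, hG.deg_eq_one_iff hc]
  have hmemL : ∀ i c, c ∈ leafFamily 2 G i ↔ c ≠ κ i := fun i c => by
    simp [leafFamily, hG.deg_eq_one_iff hc]
  have hmemH : ∀ i, hubFamily 2 G i = {κ i} := fun i => by
    ext c; simp [hubFamily, hG.deg_eq_one_iff hc]
  have hcardL : ∀ i, (leafFamily 2 G i).card = 2 := fun i => by
    have : leafFamily 2 G i = Finset.univ.erase (κ i) := by ext c; simp [hmemL]
    rw [this, Finset.card_erase_of_mem (Finset.mem_univ _), Finset.card_univ, hc]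
  have hneL : ∀ i, (leafFamily 2 G i).Nonempty := fun i => Finset.card_pos.1 (by simp [hcardL])
  have uL : ∀ i c, c ≠ κ i → unif (leafFamily 2 G i) c = 1 / 2 := fun i c h => by
    rw [unif_of_mem ((hmemL i c).2 h), hcardL]; norm_num
  have uLκ : ∀ i, unif (leafFamily 2 G i) (κ i) = 0 := fun i => by
    by_contra h
    exact (hmemL i _).1 (unif_ne_zero (hneL i) h) rfl
  have uH : ∀ i c, c ≠ κ i → unif (hubFamily 2 G i) c = 0 := fun i c h => by
    by_contra h'
    have := unif_ne_zero (by simp [hmemH]) h'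
    rw [hmemH, Finset.mem_singleton] at this
    exact h this
  have uHκ : ∀ i, unif (hubFamily 2 G i) (κ i) = 1 := fun i => by
    rw [hmemH, unif_of_mem (Finset.mem_singleton_self _)]; simp
  have probκ : ∀ h, π.prob G h κ = (1 - leafProb (1 / α) (1 / β) 0 G h) *
      (1 - leafProb (1 / α) (1 / β) 1 G h) := fun h => by
    rw [hπ, crossProtocol, Protocol.ofWeights_prob, Fin.prod_univ_two, uLκ, uLκ, uHκ, uHκ]
    ring
  have probL : ∀ h x y, x ≠ κ 0 → y ≠ κ 1 → π.prob G h (pair x y) =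
      leafProb (1 / α) (1 / β) 0 G h * leafProb (1 / α) (1 / β) 1 G h / 4 := fun h x y hx hy => by
    rw [hπ, crossProtocol, Protocol.ofWeights_prob, Fin.prod_univ_two, pair_zero, pair_one,
      uL _ _ hx, uL _ _ hy, uH _ _ hx, uH _ _ hy]
    ring
  have hα0 : α ≠ 0 := by positivity
  have hβ0 : β ≠ 0 := by positivity
  have hκl : ¬G.IsLeafProfile κ := by simp [hleaf]
  have key := π.ectFrom_le (fun _ : G.History => True) (crossValue α β)
    (fun h _ => by unfold crossValue; split <;> [linarith; (split <;> linarith)])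
    (fun _ _ _ _ _ => trivial) (fun h _ => ?_) [] trivial
  · exact key
  rcases hfl : firstLeaf h with _ | σ
  · obtain ⟨x, hx⟩ := hneL 0
    obtain ⟨y, hy⟩ := hneL 1
    rw [hmemL] at hx hy
    obtain ⟨e0, h00, -⟩ := exists_equiv_fin_three (hc 0) hx.symm
    obtain ⟨e1, h10, -⟩ := exists_equiv_fin_three (hc 1) hy.symm
    have ne0 : ∀ a : Fin 3, a ≠ 0 → e0 a ≠ κ 0 := fun a ha h => ha (e0.injective (h.trans h00.symm))
    have ne1 : ∀ a : Fin 3, a ≠ 0 → e1 a ≠ κ 1 := fun a ha h => ha (e1.injective (h.trans h10.symm))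
    have lp : ∀ i, leafProb (1 / α) (1 / β) i G h = 1 / α := fun i => by
      simp only [leafProb, hfl]
    have vκ : crossValue α β (h ++ [κ]) = α := by
      simp only [crossValue, firstLeaf_append, hfl, if_neg hκl, Option.or_none]
    have vL : ∀ x y, x ≠ κ 0 → y ≠ κ 1 → crossValue α β (h ++ [pair x y]) = β := by
      intro x y hx hy
      have : G.IsLeafProfile (pair x y) := (hleaf _).2 ⟨hx, hy⟩
      simp [crossValue, firstLeaf_append, hfl, this, firstBreak_append,
        firstBreak_eq_none_of_firstLeaf hfl]
    have v0 : crossValue α β h = α := by simp only [crossValue, hfl]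
    rw [hG.sum_fail_eq e0 e1 h00 h10, probκ, vκ, v0]
    simp only [probL h _ _ (ne0 1 (by decide)) (ne1 1 (by decide)),
      probL h _ _ (ne0 1 (by decide)) (ne1 2 (by decide)),
      probL h _ _ (ne0 2 (by decide)) (ne1 1 (by decide)),
      probL h _ _ (ne0 2 (by decide)) (ne1 2 (by decide)),
      vL _ _ (ne0 1 (by decide)) (ne1 1 (by decide)),
      vL _ _ (ne0 1 (by decide)) (ne1 2 (by decide)),
      vL _ _ (ne0 2 (by decide)) (ne1 1 (by decide)),
      vL _ _ (ne0 2 (by decide)) (ne1 2 (by decide)), lp]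
    rw [← hα]
    apply le_of_eq
    field_simp
    ring
  · have hσ : G.IsLeafProfile σ := by
      have := List.find?_some hfl
      simpa using this
    obtain ⟨hx, hy⟩ := (hleaf σ).1 hσ
    obtain ⟨e0, h00, h01⟩ := exists_equiv_fin_three (hc 0) hx.symm
    obtain ⟨e1, h10, h11⟩ := exists_equiv_fin_three (hc 1) hy.symm
    have ne0 : ∀ a : Fin 3, a ≠ 0 → e0 a ≠ κ 0 := fun a ha h => ha (e0.injective (h.trans h00.symm))
    have ne1 : ∀ a : Fin 3, a ≠ 0 → e1 a ≠ κ 1 := fun a ha h => ha (e1.injective (h.trans h10.symm))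
    rw [hG.sum_fail_eq e0 e1 h00 h10, probκ]
    simp only [probL h _ _ (ne0 1 (by decide)) (ne1 1 (by decide)),
      probL h _ _ (ne0 1 (by decide)) (ne1 2 (by decide)),
      probL h _ _ (ne0 2 (by decide)) (ne1 1 (by decide)),
      probL h _ _ (ne0 2 (by decide)) (ne1 2 (by decide))]
    rcases hfb : firstBreak σ h with _ | τ
    · have lp : ∀ i, leafProb (1 / α) (1 / β) i G h = 1 / β := fun i => by
        simp only [leafProb, hfl, hfb]
      have v0 : crossValue α β h = β := by simp only [crossValue, hfl, hfb]
      have vκ : crossValue α β (h ++ [κ]) = β := by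
        simp [crossValue, firstLeaf_append, hfl, firstBreak_append, hfb, hκl]
      -- Index 1 is the leaf from the first leaf pair. The symmetry breaks exactly when one player
      -- repeats it and the other does not.
      have vL : ∀ a b : Fin 3, a ≠ 0 → b ≠ 0 → crossValue α β (h ++ [pair (e0 a) (e1 b)]) =
          if (a = 1 ↔ b = 1) then β else 1 := by
        intro a b ha hb
        have : G.IsLeafProfile (pair (e0 a) (e1 b)) := (hleaf _).2 ⟨ne0 a ha, ne1 b hb⟩
        simp only [crossValue, firstLeaf_append, hfl, Option.some_or, firstBreak_append, hfb, this,
          true_and, Option.none_or, Fin.exists_fin_two, pair_zero, pair_one, ← h01, ← h11,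
          e0.apply_eq_iff_eq, e1.apply_eq_iff_eq, ne_eq]
        by_cases h1 : a = 1 <;> by_cases h2 : b = 1 <;> simp [h1, h2]
      rw [vL 1 1 (by decide) (by decide), vL 1 2 (by decide) (by decide),
        vL 2 1 (by decide) (by decide), vL 2 2 (by decide) (by decide), vκ, v0]
      simp only [lp]
      simp
      apply le_of_eq
      field_simp
      linarith
    · have hτ : (∃ i, τ i = σ i) ∧ ∃ i, τ i ≠ σ i := by
        have := List.find?_some hfb
        simp only [decide_eq_true_eq] at this
        exact this.2
      have lp : ∀ i, leafProb (1 / α) (1 / β) i G h = if τ i = σ i then 0 else 1 := fun i => by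
        simp only [leafProb, hfl, hfb]
      have v0 : crossValue α β h = 1 := by simp only [crossValue, hfl, hfb]
      rw [v0, lp, lp]
      rw [Fin.exists_fin_two, Fin.exists_fin_two] at hτ
      by_cases h1 : τ 0 = σ 0
      · have h2 : ¬τ 1 = σ 1 := by tauto
        simp [h1, h2]
      · have h2 : τ 1 = σ 1 := by tauto
        simp [h1, h2]

end CrossUpperBound

/-! ### Size three: only the cross game attains the maximum. -/

section SizeThree

variable {G : WLCGame 2}

/-- The hubs of the game `G(1 × 2 + 2 × 1)`. -/
def oneTwoTwoOneHubs : oneTwoTwoOne.Profile :=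
  pair (G := oneTwoTwoOne) (Sum.inl (0 : Fin 1)) (Sum.inr (0 : Fin 1))

theorem isCross_oneTwoTwoOne : IsCross oneTwoTwoOne oneTwoTwoOneHubs := by
  intro σ
  have h0 : ∀ σ ∈ oneTwoTwoOne.win, (∃ x : Fin 1, σ 0 = Sum.inl x) ↔ ∃ y : Fin 2, σ 1 = Sum.inl y := by
    rintro σ (⟨τ, -, rfl⟩ | ⟨τ, -, rfl⟩)
    · exact ⟨fun _ => ⟨τ 1, rfl⟩, fun _ => ⟨τ 0, rfl⟩⟩
    · constructor <;> rintro ⟨x, hx⟩ <;> exact (Sum.inr_ne_inl hx).elim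
  obtain ⟨x, y, rfl⟩ : ∃ x y, σ = pair x y := ⟨σ 0, σ 1, (pair_eta σ).symm⟩
  change Fin 1 ⊕ Fin 2 at x
  change Fin 2 ⊕ Fin 1 at y
  change _ ↔ (x = Sum.inl 0 ↔ ¬y = Sum.inr 0)
  rcases x with x | x <;> rcases y with y | y
  · refine iff_of_true (Or.inl ⟨pair (G := universal ![1, 2]) x y, trivial, profile_ext rfl rfl⟩) ?_
    simp [Subsingleton.elim x 0]
  · refine iff_of_false (fun h => ?_) (by simp [Subsingleton.elim x 0, Subsingleton.elim y 0])
    obtain ⟨z, hz⟩ := (h0 _ h).1 ⟨x, rfl⟩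
    exact Sum.inr_ne_inl hz
  · refine iff_of_false (fun h => ?_) (by simp)
    obtain ⟨z, hz⟩ := (h0 _ h).2 ⟨y, rfl⟩
    exact Sum.inr_ne_inl hz
  · refine iff_of_true (Or.inr ⟨pair (G := universal ![2, 1]) x y, trivial, profile_ext rfl rfl⟩) ?_
    simp [Subsingleton.elim y 0]

theorem card_choice_oneTwoTwoOne (i : Fin 2) : Fintype.card (oneTwoTwoOne.Choice i) = 3 := by
  revert i
  rw [Fin.forall_fin_two]
  constructor
  · exact (Fintype.card_sum (α := Fin 1) (β := Fin 2)).trans (by simp)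
  · exact (Fintype.card_sum (α := Fin 2) (β := Fin 1)).trans (by simp)

/-- The optimal expected coordination time of cross games of size three. -/
def crossECT : ℝ := (1 + Real.sqrt (4 + Real.sqrt 17)) / 2

theorem sqrt_seventeen_gt : 4 < Real.sqrt 17 := Real.lt_sqrt_of_sq_lt (by norm_num)

/-- 17/9 = 3 - 2 · (5/9) is the bound from a first round won with probability 5/9. -/
theorem crossECT_gt : 17 / 9 < crossECT := by
  have h := sqrt_seventeen_gt
  have : 25 / 9 < Real.sqrt (4 + Real.sqrt 17) := Real.lt_sqrt_of_sq_lt (by linarith)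
  rw [crossECT]
  linarith

theorem crossECT_sq : crossECT ^ 2 - crossECT = (3 + Real.sqrt 17) / 4 := by
  have h := sqrt_seventeen_gt
  have := Real.sq_sqrt (show 0 ≤ 4 + Real.sqrt 17 by linarith)
  rw [crossECT]
  linarith

/-- Needed for β ≤ α, which for β = α² - α and positive α means α ≤ 2. -/
theorem crossECT_lt_two : crossECT < 2 := by
  have h : Real.sqrt 17 < 5 := (Real.sqrt_lt' (by norm_num)).2 (by norm_num)
  have : Real.sqrt (4 + Real.sqrt 17) < 3 := (Real.sqrt_lt' (by norm_num)).2 (by linarith)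
  rw [crossECT]
  linarith

theorem isOptimalECT_oneTwoTwoOne : IsOptimalECT oneTwoTwoOne (ENNReal.ofReal crossECT) := by
  set β := (3 + Real.sqrt 17) / 4 with hβ
  have h17 := sqrt_seventeen_gt
  have hsq := Real.sq_sqrt (show (0 : ℝ) ≤ 17 by norm_num)
  have hα := crossECT_gt
  have hα2 := crossECT_lt_two
  have hβ1 : 1 ≤ β := by rw [hβ]; linarith
  have hαβ : β ≤ crossECT := by
    rw [hβ, ← crossECT_sq]; nlinarith
  have hβ2 : 2 * β ^ 2 = 3 * β + 1 := by rw [hβ]; linarith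
  have hp : ∀ t : ℝ, 1 ≤ t → 1 / t ∈ Set.Icc (0 : ℝ) 1 := fun t ht =>
    ⟨by positivity, (div_le_one (by linarith)).2 ht⟩
  have hlow : ∀ π : Protocol 2, π.IsStructural → ENNReal.ofReal crossECT ≤ π.ect oneTwoTwoOne :=
    fun π hπ => isCross_oneTwoTwoOne.le_ect hπ (card_choice_oneTwoTwoOne 0)
      (card_choice_oneTwoTwoOne 1) hβ1 hαβ crossECT_sq hβ2
  have hα1 : 1 ≤ crossECT := by linarith
  refine ⟨⟨crossProtocol 2 (hp _ hα1) (hp _ hβ1), crossProtocol_isStructural _ _,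
    le_antisymm ?_ (hlow _ (crossProtocol_isStructural _ _))⟩, ?_⟩
  · exact isCross_oneTwoTwoOne.crossProtocol_ect_le card_choice_oneTwoTwoOne hβ1 hα1 crossECT_sq hβ2
      _ _
  · rintro _ ⟨π, hπ, rfl⟩
    exact hlow π hπ

/-- A game of size `3 × 3` with four winning profiles in which the two choices of degree two do not
win against each other is `G(1 × 2 + 2 × 1)`. -/
theorem isCross_of_numWins_eq_four (hw : G.numWins = 4) {κ : G.Profile} (hκ : κ ∉ G.win)
    (hd : ∀ i, G.deg i (κ i) = 2) : IsCross G κ := by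
  classical
  -- The winning pairs at the two hubs form disjoint sets because κ loses; 2 + 2 = 4 shows that they
  -- exhaust the winning relation.
  have hpart : ∀ σ ∈ G.win, σ 0 = κ 0 ∨ σ 1 = κ 1 := by
    have hdisj : Disjoint (Finset.univ.filter fun σ : G.Profile => σ ∈ G.win ∧ σ 0 = κ 0)
        (Finset.univ.filter fun σ : G.Profile => σ ∈ G.win ∧ σ 1 = κ 1) := by
      rw [Finset.disjoint_filter]
      rintro σ - ⟨h1, h2⟩ ⟨-, h3⟩
      exact hκ (profile_ext h2 h3 ▸ h1)
    have hsub : (Finset.univ.filter fun σ : G.Profile => σ ∈ G.win ∧ σ 0 = κ 0) ∪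
        (Finset.univ.filter fun σ : G.Profile => σ ∈ G.win ∧ σ 1 = κ 1) ⊆
        Finset.univ.filter fun σ : G.Profile => σ ∈ G.win := by
      intro σ hσ
      simp only [Finset.mem_union, Finset.mem_filter, Finset.mem_univ, true_and] at hσ ⊢
      tauto
    have := Finset.eq_of_subset_of_card_le hsub (by
      rw [Finset.card_union_of_disjoint hdisj]
      have h0 := hd 0
      have h1 := hd 1
      unfold deg at h0 h1
      unfold numWins at hw
      omega)
    intro σ hσ
    have h1 : σ ∈ Finset.univ.filter fun σ : G.Profile => σ ∈ G.win := by simp [hσ]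
    rw [← this] at h1
    simp only [Finset.mem_union, Finset.mem_filter, Finset.mem_univ, true_and] at h1
    tauto
  intro σ
  constructor
  · intro h
    have := hpart σ h
    have h2 : ¬(σ 0 = κ 0 ∧ σ 1 = κ 1) := fun h' => hκ (profile_ext h'.1 h'.2 ▸ h)
    tauto
  · intro h
    by_cases h0 : σ 0 = κ 0
    · have h1 := h.1 h0
      -- A leaf lies in some winning pair, whose other choice can only be the opposing hub.
      obtain ⟨τ, hτ, e⟩ := G.exists_win 1 (σ 1)
      have := (hpart τ hτ).resolve_right (e ▸ h1)
      exact profile_ext (σ := τ) (τ := σ) (this.trans h0.symm) e ▸ hτ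
    · have h1 : σ 1 = κ 1 := by tauto
      obtain ⟨τ, hτ, e⟩ := G.exists_win 0 (σ 0)
      have := (hpart τ hτ).resolve_left (e ▸ h0)
      exact profile_ext (σ := τ) (τ := σ) e (this.trans h1.symm) ▸ hτ

/-- In all games of size three but `G(1 × 2 + 2 × 1)`, the expected coordination time can be made
smaller than `crossECT`. -/
theorem exists_ect_lt_of_mem_choiceGames_three (hG : G ∈ choiceGames 3)
    (hne : ¬Nonempty (Renaming oneTwoTwoOne G)) :
    ∃ π : Protocol 2, π.IsStructural ∧ π.ect G < ENNReal.ofReal crossECT := by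
  classical
  have hα := crossECT_gt
  have hθ : 0 < crossECT := by linarith
  have hm : max (Fintype.card (G.Choice 0)) (Fintype.card (G.Choice 1)) = 3 := hG
  obtain ⟨i, j, hij, hi, hj⟩ : ∃ i j : Fin 2, i ≠ j ∧ Fintype.card (G.Choice i) = 3 ∧
      Fintype.card (G.Choice j) ≤ 3 := by
    rcases max_choice (Fintype.card (G.Choice 0)) (Fintype.card (G.Choice 1)) with e | e
    · exact ⟨0, 1, zero_ne_one, by omega, by omega⟩
    · exact ⟨1, 0, one_ne_zero, by omega, by omega⟩
  have pj : 0 < Fintype.card (G.Choice j) := Fintype.card_pos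
  have hcard : Fintype.card (G.Choice 0) * Fintype.card (G.Choice 1) =
      3 * Fintype.card (G.Choice j) := by
    have : (i = 0 ∧ j = 1) ∨ (i = 1 ∧ j = 0) := by omega
    rcases this with ⟨rfl, rfl⟩ | ⟨rfl, rfl⟩
    · rw [hi]
    · rw [hi, mul_comm]
  have hw := card_choice_le_numWins G i
  -- Winning probability at least 5/9 in a uniform first round. Otherwise the opponent has two
  -- choices and there are three winning pairs, or the game is 3 × 3 with three or four.
  by_cases hunif : 15 * Fintype.card (G.Choice j) ≤ 9 * G.numWins
  · refine exists_ect_lt_of_family univ_isInvariant hθ ?_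
    rw [winSum_unif_univ, ← Nat.cast_mul, hcard]
    have : (5 : ℝ) / 9 ≤ G.numWins / ((3 * Fintype.card (G.Choice j) : ℕ) : ℝ) := by
      rw [div_le_div_iff₀ (by norm_num) (by positivity)]
      have : ((15 * Fintype.card (G.Choice j) : ℕ) : ℝ) ≤ ((9 * G.numWins : ℕ) : ℝ) :=
        Nat.cast_le.2 hunif
      push_cast at this ⊢
      linarith
    linarith
  rcases hj.lt_or_eq with hj | hj
  · refine exists_ect_lt_of_le hθ (t := 1) (by linarith) ?_
    have sj := sum_deg G j
    have hr : ∑ c, G.deg j c = Fintype.card (G.Choice j) + 1 := by omega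
    exact exists_ect_le_one_of_card_ne hij.symm (by omega) 2
      (card_filter_eq_two _ (deg_pos j) (le_of_sum_eq_card_add _ (deg_pos j) hr) hr).1
  have hall : ∀ k, Fintype.card (G.Choice k) = 3 := by
    intro k
    have : k = i ∨ k = j := by omega
    rcases this with rfl | rfl <;> assumption
  rcases (by omega : G.numWins = 3 ∨ G.numWins = 4) with he | he
  · obtain ⟨r⟩ := nonempty_renaming_choiceMatching hall he
    refine exists_ect_lt_of_le hθ (t := 5 / 3) (by linarith)
      ⟨loopAvoidance 2, loopAvoidance_isStructural 2, ?_⟩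
    rw [(loopAvoidance_isStructural 2).ect_eq r]
    exact loopAvoidance_ect_three
  have hsum : ∀ k, ∑ c, G.deg k c = Fintype.card (G.Choice k) + 1 := fun k => by
    rw [sum_deg, he, hall]
  have hle := fun k => le_of_sum_eq_card_add _ (deg_pos k) (hsum k)
  have hone : ∀ k, (degFamily 2 3 2 G k).card = 1 := fun k => by
    rw [card_degFamily (hall k)]
    exact (card_filter_eq_two _ (deg_pos k) (hle k) (hsum k)).1
  choose κ hκ using fun k => Finset.card_eq_one.1 (hone k)
  have hκ2 : ∀ k, G.deg k (κ k) = 2 := fun k =>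
    (mem_degFamily.1 (by rw [hκ]; exact Finset.mem_singleton_self _ :
      κ k ∈ degFamily 2 3 2 G k)).2
  -- Each player has a unique choice of degree two. If these win together, they are simply played;
  -- otherwise the game is the cross game.
  by_cases hwin : κ ∈ G.win
  · refine exists_ect_lt_of_family (degFamily_isInvariant 2 3 2) hθ ?_
    rw [hκ, hκ, winSum_unif_eq_one (Finset.singleton_nonempty _) (Finset.singleton_nonempty _)]
    · linarith
    · intro σ h0 h1
      rw [Finset.mem_singleton] at h0 h1
      exact profile_ext (σ := κ) (τ := σ) h0.symm h1.symm ▸ hwin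
  · refine absurd ?_ hne
    have hcross := isCross_of_numWins_eq_four he hwin hκ2
    have he : ∀ k, ∃ e : oneTwoTwoOne.Choice k ≃ G.Choice k, e (oneTwoTwoOneHubs k) = κ k := by
      intro k
      obtain ⟨e⟩ := Fintype.card_eq.1 ((card_choice_oneTwoTwoOne k).trans (hall k).symm)
      exact ⟨e.trans (Equiv.swap (e (oneTwoTwoOneHubs k)) (κ k)), by simp⟩
    choose e he using he
    exact isCross_oneTwoTwoOne.nonempty_renaming hcross (e 0) (e 1) (he 0) (he 1)

end SizeThree

/-! ### Assembling the three cases. -/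

theorem isOptimalECT_choiceMatching {m : ℕ} [NeZero m] {r : ℝ}
    (hr : r ≤ 1 + (m - 1) / m * mirrorValue (m - 2))
    (h : ∃ π : Protocol 2, π.IsStructural ∧
      π.ect (choiceMatching m) ≤ ENNReal.ofReal r) :
    IsOptimalECT (choiceMatching m) (ENNReal.ofReal r) := by
  have hlow : ∀ π : Protocol 2, π.IsStructural →
      ENNReal.ofReal r ≤ π.ect (choiceMatching m) := fun π hπ =>
    (ENNReal.ofReal_le_ofReal hr).trans hπ.le_ect_choiceMatching
  obtain ⟨π, hπ, h⟩ := h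
  refine ⟨⟨π, hπ, le_antisymm h (hlow π hπ)⟩, ?_⟩
  rintro _ ⟨π, hπ, rfl⟩
  exact hlow π hπ

theorem choiceMatching_mem_choiceGames (m : ℕ) [NeZero m] :
    choiceMatching m ∈ choiceGames m := by
  have : ∀ i, Fintype.card ((choiceMatching m).Choice i) = m := fun _ => Fintype.card_fin m
  rw [choiceGames, Set.mem_ofPred_eq, this, this, max_self]

theorem not_isOptimalECT_of_lt {G : WLCGame 2} {r : ENNReal}
    (h : ∃ π : Protocol 2, π.IsStructural ∧ π.ect G < r) : ¬IsOptimalECT G r := by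
  rintro ⟨-, hmin⟩
  obtain ⟨π, hπ, hlt⟩ := h
  exact hlt.not_ge (hmin ⟨π, hπ, rfl⟩)

/-- If `r` is the optimal expected coordination time of `H` and all games in the class that are not
renamings of `H` do better, then `r` is the greatest optimal expected coordination time, and it is
attained exactly by the renamings of `H`. -/
theorem isGreatestOptimalECT_and_iff {𝒢 : Set (WLCGame 2)} {H : WLCGame 2} {r : ENNReal}
    (hH : H ∈ 𝒢) (hr : IsOptimalECT H r)
    (hlt : ∀ G ∈ 𝒢, ¬Nonempty (Renaming H G) →
      ∃ π : Protocol 2, π.IsStructural ∧ π.ect G < r) :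
    IsGreatestOptimalECT 𝒢 r ∧
      ∀ G ∈ 𝒢, IsOptimalECT G r ↔ Nonempty (Renaming H G) := by
  have hiff : ∀ G ∈ 𝒢, IsOptimalECT G r ↔ Nonempty (Renaming H G) := fun G hG =>
    ⟨fun h => by_contra fun hne => not_isOptimalECT_of_lt (hlt G hG hne) h,
      fun ⟨ρ⟩ => (ρ.isOptimalECT_iff r).2 hr⟩
  refine ⟨⟨⟨H, hH, hr⟩, fun G hG => ?_⟩, hiff⟩
  by_cases hne : Nonempty (Renaming H G)
  · obtain ⟨π, hπ, h⟩ := ((hiff G hG).2 hne).1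
    exact ⟨π, hπ, h.le⟩
  · obtain ⟨π, hπ, h⟩ := hlt G hG hne
    exact ⟨π, hπ, h.le⟩

end WLCGame

end

theorem mainTheorem1 :
    (∀ m : ℕ, 1 ≤ m → m ≠ 3 → m ≠ 5 →
      WLCGame.IsGreatestOptimalECT (WLCGame.choiceGames m) (ENNReal.ofReal (3 - 2 / (m : ℝ)))) ∧
    (WLCGame.IsGreatestOptimalECT (WLCGame.choiceGames 5) (ENNReal.ofReal (2 + 1 / 3)) ∧
      ∀ G ∈ WLCGame.choiceGames 5,
        WLCGame.IsOptimalECT G (ENNReal.ofReal (2 + 1 / 3)) ↔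
          Nonempty (WLCGame.Renaming (WLCGame.choiceMatching 5) G)) ∧
    (WLCGame.IsGreatestOptimalECT (WLCGame.choiceGames 3)
        (ENNReal.ofReal ((1 + Real.sqrt (4 + Real.sqrt 17)) / 2)) ∧
      ∀ G ∈ WLCGame.choiceGames 3,
        WLCGame.IsOptimalECT G (ENNReal.ofReal ((1 + Real.sqrt (4 + Real.sqrt 17)) / 2)) ↔
          Nonempty (WLCGame.Renaming WLCGame.oneTwoTwoOne G)) := by
  refine ⟨fun m hm h3 h5 => ?_, ?_, ?_⟩
  · have : NeZero m := ⟨by omega⟩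
    have hmem := WLCGame.choiceMatching_mem_choiceGames m
    refine ⟨⟨_, hmem, WLCGame.isOptimalECT_choiceMatching ?_
      (WLCGame.exists_ect_le_of_mem_choiceGames hmem)⟩,
      fun G hG => WLCGame.exists_ect_le_of_mem_choiceGames hG⟩
    -- For m ∉ {3, 5} the truncated difference m - 2 is neither 1 nor 3, so the lower bound is 1 +
    -- 2(m - 1)/m = 3 - 2/m.
    rw [WLCGame.mirrorValue, if_neg (by omega), if_neg (by omega)]
    have : (m : ℝ) ≠ 0 := Nat.cast_ne_zero.2 (by omega)
    apply le_of_eq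
    field_simp
    ring
  · refine WLCGame.isGreatestOptimalECT_and_iff (WLCGame.choiceMatching_mem_choiceGames 5)
      (WLCGame.isOptimalECT_choiceMatching ?_
        ⟨_, WLCGame.loopAvoidance_isStructural 2, WLCGame.loopAvoidance_ect_five⟩)
      fun G hG => WLCGame.exists_ect_lt_of_mem_choiceGames_five hG
    norm_num [WLCGame.mirrorValue]
  · refine WLCGame.isGreatestOptimalECT_and_iff ?_ WLCGame.isOptimalECT_oneTwoTwoOne
      fun G hG => WLCGame.exists_ect_lt_of_mem_choiceGames_three hG
    rw [WLCGame.choiceGames, Set.mem_ofPred_eq, WLCGame.card_choice_oneTwoTwoOne,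
      WLCGame.card_choice_oneTwoTwoOne, max_self]
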